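/- **Setting.** Let $q$ (connected) and $G$ be finite undirected vertex-labelled graphs. An embedding of $q$ in $G$ is an injective map $V_q\to V_G$ that preserves adjacency and labels; a partial embedding is an embedding $M$ of an induced subgraph of $q$; $w_M$ is the number of embeddings of $q$ in $G$ extending $M$, so that $w_\emptyset$ is the number of all embeddings. For a vertex $x$ of a graph $g$ let $d_g(x,l)$ be the number of neighbours of $x$ with label $l$, and let $C_{init}(u)$ be the set of $v\in V_G$ with the label of $u$ and $d_G(v,l)\ge d_q(u,l)$ for all $l$. A candidate space consists of sets $C(u)\subseteq C_{init}(u)$ ($u\in V_q$) and, for adjacent $u,u'$, sets $E_{CS}(u,u')$ of pairs $(v,v')\in E_G$ with $v\in C_{init}(u)$, $v'\in C_{init}(u')$, such that $f(u)\in C(u)$ and $(f(u),f(u'))\in E_{CS}(u,u')$ for every embedding $f$. Put $C(u'\mid u,v)=\{v' : (v,v')\in E_{CS}(u,u')\}$. **Algorithm.** Fix a candidate space, a real $k\ge 1$ (so that $1/k$ is the sampling ratio) and a monotone rounding $\mathrm{rd}:\mathbb R\to\mathbb N$ with $\mathrm{rd}(n)=n$ for $n\in\mathbb N$. $\mathrm{EstimateW}(M,ub)$,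 for a real $ub$, returns a pair (estimate $\hat w_M$, number of trials): 1. If $|M|=|V_q|$, return $(1,1)$. 2. Choose a vertex $u$: the one with the smallest $|C(u)|$ if $M=\emptyset$, else the unmapped vertex with the most neighbours mapped by $M$ (ties are broken by a fixed numbering). Compute $C_M(u)=\bigcap_{(u',v')\in M,\ u'\in N_q(u)}C(u\mid u',v')\setminus \mathrm{im}\,M$ (and $C_\emptyset(u)=C(u)$) by scanning the smallest of these sets and looking its elements up in the others. If $C_M(u)=\emptyset$, return $(0,1)$. 3. Draw a uniformly random subset $S=\{S_1<\dots<S_s\}$ of $C_M(u)$ of size $s=\max(1,\min(|C_M(u)|,\mathrm{rd}(\min(|C_M(u)|/k,ub))))$. For $i=1,\dots,s$ call $\mathrm{EstimateW}(M\cup\{(u,S_i)\},\,(ub-t_i)/(s-i+1))$, where $t_i$ is the total number of trials returned by the previous calls. Return $\bigl(\frac{|C_M(u)|}{s}\sum_i\hat w_{M\cup\{(u,S_i)\}},\ \text{total number of trials}\bigr)$. The algorithm is the call $\mathrm{EstimateW}(\emptyset,ub)$. A step is a comparison, an adjacency or membership test, reading the size or an element of a candidate set, treating one candidate while drawing the random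 subset, or a constant amount of arithmetic; the candidate space is given. **Theorem.** 1. (Unbiased.) For all $k\ge1$ and all $ub\in\mathbb R$, the estimate returned by $\mathrm{EstimateW}(\emptyset,ub)$ has expectation $w_\emptyset$, the number of embeddings of $q$ in $G$. More generally, for every partial embedding $M$ and every $ub$, the estimate returned by $\mathrm{EstimateW}(M,ub)$ has expectation $w_M$. 2. (Consistent.) With sampling ratio 100% ($k=1$), the estimate converges in probability to $w_\emptyset$ as $ub\to\infty$. Moreover, for all sufficiently large $ub$ the algorithm is exhaustive backtracking: with probability one the estimate equals $w_\emptyset$, which is the number of embeddings found by backtracking over all of $C_M(u)$ at every node, and the number of trials equals the number of leaves of that search tree. 3. (Running time.) Assume that $q$ has at least two vertices. Let $$AGM(q)=\inf_x\prod_{e\in E_q}|R_e|^{x_e}$$ over all fractional edge covers $x$ of $q$ ($x_e\ge0$ and $\sum_{e\ni u}x_e\ge1$ for each $u\in V_q$), where for $e=\{u,u'\}$ the relation $R_e$ is the set of ordered pairs $(v,v')$ of adjacent vertices of $G$ such that $v$ has the label of $u$ and $v'$ the label of $u'$. There are absolute constants $c,d$ such that for all $q$, $G$, candidate spaces, roundings,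 $k\ge1$ and $ub$, every run of the algorithm makes at most $c\,|V_q|^{d}\max(1,AGM(q))$ steps; that is, for a fixed query the worst-case running time is $O(AGM(q))$ whenever $AGM(q)\neq 0$. -/

import Mathlib

noncomputable section

/-! ## Labelled graphs and embeddings -/

/-- A finite undirected graph (its vertex set is the type `V`) with vertex labels in `Λ`. -/
structure LabeledGraph (V Λ : Type) where
  graph : SimpleGraph V
  label : V → Λ

/-- `f` is an (isomorphic) embedding of `q` in `G`: it is injective and preserves adjacency and
labels. -/
structure IsEmbedding {Vq VG Λ : Type} (q : LabeledGraph Vq Λ) (G : LabeledGraph VG Λ)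
    (f : Vq → VG) : Prop where
  injective : Function.Injective f
  adj : ∀ u u', q.graph.Adj u u' → G.graph.Adj (f u) (f u')
  label : ∀ u, G.label (f u) = q.label u

/-- The number of embeddings of `q` in `G`: the subgraph cardinality. -/
def numEmbeddings {Vq VG Λ : Type} (q : LabeledGraph Vq Λ) (G : LabeledGraph VG Λ) : ℕ :=
  Nat.card {f : Vq → VG // IsEmbedding q G f}

/-- A vertex mapping, stored as the list of its pairs `(u, v)`, is a partial embedding if it is an
embedding of the subgraph of `q` induced by its domain. -/
structure IsPartialEmbedding {Vq VG Λ : Type} (q : LabeledGraph Vq Λ) (G : LabeledGraph VG Λ)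
    (M : List (Vq × VG)) : Prop where
  functional : (M.map Prod.fst).Nodup
  injective : (M.map Prod.snd).Nodup
  adj : ∀ p ∈ M, ∀ p' ∈ M, q.graph.Adj p.1 p'.1 → G.graph.Adj p.2 p'.2
  label : ∀ p ∈ M, G.label p.2 = q.label p.1

/-- `w_M`: the number of embeddings of `q` in `G` that extend `M`. -/
def numExtensions {Vq VG Λ : Type} (q : LabeledGraph Vq Λ) (G : LabeledGraph VG Λ)
    (M : List (Vq × VG)) : ℕ :=
  Nat.card {f : Vq → VG // IsEmbedding q G f ∧ ∀ p ∈ M, f p.1 = p.2}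

/-! ## Candidate spaces -/

/-- `d_g(x, l)`: the number of neighbours of `x` with label `l`. -/
def labelDegree {V Λ : Type} (g : LabeledGraph V Λ) (x : V) (l : Λ) : ℕ :=
  Nat.card {y : V // g.graph.Adj x y ∧ g.label y = l}

/-- The initial candidate set of a query vertex `u`. -/
def initialCand {Vq VG Λ : Type} (q : LabeledGraph Vq Λ) (G : LabeledGraph VG Λ) (u : Vq) :
    Set VG :=
  {v | G.label v = q.label u ∧ ∀ l, labelDegree q u l ≤ labelDegree G v l}

/-- A candidate space of `q` in `G`: a subset of the initial candidate vertices `C(u)` and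
candidate edges `E_CS(u, u')` (pairs `(v, v')`, with `v` for `u` and `v'` for `u'`) from which no
vertex or edge has been removed that is used by an embedding.  How far, and by which safety
conditions, the initial candidate space was refined is left open. -/
structure CandidateSpace {Vq VG Λ : Type} (q : LabeledGraph Vq Λ) (G : LabeledGraph VG Λ) where
  cand : Vq → Finset VG
  edges : Vq → Vq → Finset (VG × VG)
  cand_initial : ∀ u, ∀ v ∈ cand u, v ∈ initialCand q G u
  edges_initial : ∀ u u', q.graph.Adj u u' → ∀ p ∈ edges u u',
    G.graph.Adj p.1 p.2 ∧ p.1 ∈ initialCand q G u ∧ p.2 ∈ initialCand q G u'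
  cand_complete : ∀ f, IsEmbedding q G f → ∀ u, f u ∈ cand u
  edges_complete : ∀ f, IsEmbedding q G f → ∀ u u', q.graph.Adj u u' →
    (f u, f u') ∈ edges u u'

open scoped Classical in
/-- `C(u ∣ u', v') = {v ∣ (v', v) ∈ E_CS(u', u)}`. -/
def CandidateSpace.nbrs {Vq VG Λ : Type} [Fintype VG] {q : LabeledGraph Vq Λ}
    {G : LabeledGraph VG Λ} (CS : CandidateSpace q G) (u u' : Vq) (v' : VG) : Finset VG :=
  Finset.univ.filter fun v => (v', v) ∈ CS.edges u' u

/-! ## The Atserias–Grohe–Marx bound -/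

open scoped Classical in
/-- The relation of the query edge `(u, u')`: the (oriented) edges of `G` with matching labels. -/
def edgeRelation {Vq VG Λ : Type} [Fintype VG] (q : LabeledGraph Vq Λ) (G : LabeledGraph VG Λ)
    (u u' : Vq) : Finset (VG × VG) :=
  Finset.univ.filter fun p =>
    G.graph.Adj p.1 p.2 ∧ G.label p.1 = q.label u ∧ G.label p.2 = q.label u'

theorem card_edgeRelation_comm {Vq VG Λ : Type} [Fintype VG] (q : LabeledGraph Vq Λ)
    (G : LabeledGraph VG Λ) (u u' : Vq) :
    (edgeRelation q G u u').card = (edgeRelation q G u' u).card := by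
  refine Finset.card_bij (fun p _ => p.swap) ?_ ?_ ?_
  · intro p hp
    simp only [edgeRelation, Finset.mem_filter, Finset.mem_univ, true_and, Prod.fst_swap,
      Prod.snd_swap] at hp ⊢
    exact ⟨hp.1.symm, hp.2.2, hp.2.1⟩
  · intro p _ p' _ h
    exact Prod.swap_injective h
  · intro p hp
    refine ⟨p.swap, ?_, Prod.swap_swap p⟩
    simp only [edgeRelation, Finset.mem_filter, Finset.mem_univ, true_and, Prod.fst_swap,
      Prod.snd_swap] at hp ⊢
    exact ⟨hp.1.symm, hp.2.2, hp.2.1⟩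

/-- `|R_e|` for an edge `e` of `q`. -/
def relationSize {Vq VG Λ : Type} [Fintype VG] (q : LabeledGraph Vq Λ) (G : LabeledGraph VG Λ) :
    Sym2 Vq → ℕ :=
  Sym2.lift ⟨fun u u' => (edgeRelation q G u u').card, card_edgeRelation_comm q G⟩

open scoped Classical in
/-- Nonnegative weights on the edges such that every vertex gets total weight at least `1`. -/
def IsFractionalEdgeCover {V : Type} [Fintype V] (g : SimpleGraph V) (x : Sym2 V → ℝ) : Prop :=
  (∀ e ∈ g.edgeFinset, 0 ≤ x e) ∧ ∀ u : V, 1 ≤ ∑ e ∈ g.edgeFinset with u ∈ e, x e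

open scoped Classical in
/-- `AGM(q)`: the least value of `∏ₑ |R_e| ^ xₑ` over the fractional edge covers `x` of `q`. -/
def agmBound {Vq VG Λ : Type} [Fintype Vq] [Fintype VG] (q : LabeledGraph Vq Λ)
    (G : LabeledGraph VG Λ) : ℝ :=
  ⨅ x : {x : Sym2 Vq → ℝ // IsFractionalEdgeCover q.graph x},
    ∏ e ∈ q.graph.edgeFinset, (relationSize q G e : ℝ) ^ (x.1 e)

/-! ## Programs with a step count -/

/-- A deterministic computation: its result and the number of elementary steps it made. -/
def Timed (α : Type) : Type := α × ℕ

instance : Monad Timed where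
  pure a := (a, 0)
  bind x f := ((f x.1).1, x.2 + (f x.1).2)

/-- One elementary step. -/
def Timed.tick : Timed Unit := ((), 1)

/-- A randomized computation: the joint law of its result and of the number of elementary steps. -/
def Prog (α : Type) : Type := PMF (α × ℕ)

instance : Monad Prog where
  pure a := PMF.pure (a, 0)
  bind x f := PMF.bind x fun r => PMF.map (fun s => (s.1, r.2 + s.2)) (f r.1)

/-- A deterministic computation as a randomized one. -/
def Prog.lift {α : Type} (x : Timed α) : Prog α := PMF.pure x

/-- The law of the result and the step count. -/
def Prog.law {α : Type} (x : Prog α) : PMF (α × ℕ) := x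

/-! ## Stratified graph sampling

The vertices of `q` and `G` are numbered (`LinearOrder`).  Each of these is one step: a comparison
of two vertices or numbers, an adjacency test in `q`, looking up the size of a candidate set, reading
one of its elements, a membership test in a candidate set, treating one element when a random subset
is drawn, a constant amount of arithmetic. -/

theorem powersetCard_min_nonempty {V : Type} (C : Finset V) (sz : ℕ) :
    (C.powersetCard (min sz C.card)).Nonempty :=
  Finset.powersetCard_nonempty.mpr (min_le_right _ _)

section Algorithm

variable {Vq VG Λ : Type} [Fintype Vq] [LinearOrder Vq] [Fintype VG] [LinearOrder VG]
  {q : LabeledGraph Vq Λ} {G : LabeledGraph VG Λ}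

open Timed

/-- Is `u` mapped by `M`? -/
def isMapped (u : Vq) : List (Vq × VG) → Timed Bool
  | [] => pure false
  | (u', _) :: M => do
    tick
    if u = u' then pure true else isMapped u M

open scoped Classical in
/-- The number of neighbours of `u` that are mapped by `M`. -/
def mappedNeighbors (q : LabeledGraph Vq Λ) (u : Vq) : List (Vq × VG) → Timed ℕ
  | [] => pure 0
  | (u', _) :: M => do
    tick
    let c ← mappedNeighbors q u M
    if q.graph.Adj u u' then pure (c + 1) else pure c

/-- A vertex of the given list with the smallest candidate set. -/
def smallestVertex (CS : CandidateSpace q G) : List Vq → Timed (Option Vq)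
  | [] => pure none
  | u :: l => do
    tick
    match ← smallestVertex CS l with
    | none => pure (some u)
    | some w => if (CS.cand u).card ≤ (CS.cand w).card then pure (some u) else pure (some w)

/-- An unmapped vertex of the given list with the largest number of mapped neighbours, together with
that number. -/
def mostConnectedVertex (q : LabeledGraph Vq Λ) (M : List (Vq × VG)) :
    List Vq → Timed (Option (Vq × ℕ))
  | [] => pure none
  | u :: l => do
    tick
    let best ← mostConnectedVertex q M l
    let b ← isMapped u M
    if b then pure best
    else do
      let c ← mappedNeighbors q u M
      match best with
      | none => pure (some (u, c))
      | some (w, m) => if m ≤ c then pure (some (u, c)) else pure (some (w, m))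

/-- `ChooseExtendableVertex`: at first a vertex with the smallest candidate set, later an unmapped
vertex with the largest number of mapped neighbours. -/
def chooseExtendableVertex (CS : CandidateSpace q G) (M : List (Vq × VG)) : Timed (Option Vq) :=
  if M = [] then smallestVertex CS (Finset.univ.sort (· ≤ ·))
  else do
    let r ← mostConnectedVertex q M (Finset.univ.sort (· ≤ ·))
    pure (r.map Prod.fst)

open scoped Classical in
/-- The smallest of the sets `C(u ∣ u', v')`, `(u', v') ∈ M`, `u'` a neighbour of `u`. -/
def smallestNbrs (CS : CandidateSpace q G) (u : Vq) : List (Vq × VG) → Timed (Option (Finset VG))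
  | [] => pure none
  | (u', v') :: M => do
    tick
    let r ← smallestNbrs CS u M
    if q.graph.Adj u u' then do
      tick
      match r with
      | none => pure (some (CS.nbrs u u' v'))
      | some A =>
        if (CS.nbrs u u' v').card ≤ A.card then pure (some (CS.nbrs u u' v')) else pure (some A)
    else pure r

open scoped Classical in
/-- Is `w` outside of the image of `M`, and in `C(u ∣ u', v')` for all `(u', v') ∈ M` with `u'` a
neighbour of `u`? -/
def isExtendable (CS : CandidateSpace q G) (u : Vq) (w : VG) : List (Vq × VG) → Timed Bool
  | [] => pure true
  | (u', v') :: M => do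
    tick
    if w = v' then pure false
    else do
      tick
      if q.graph.Adj u u' then do
        tick
        if w ∈ CS.nbrs u u' v' then isExtendable CS u w M else pure false
      else isExtendable CS u w M

/-- The elements of a list that pass a test. -/
def filterTimed (p : VG → Timed Bool) : List VG → Timed (List VG)
  | [] => pure []
  | w :: l => do
    tick
    let b ← p w
    let r ← filterTimed p l
    if b then pure (w :: r) else pure r

/-- `GetExtendableCandidates`: the list of the elements of `C_M(u)`, by multi-way intersection.  The
smallest set is scanned and its elements are looked up in the others; if there is none (which for a
connected query happens only for `M = ∅`) then `C(u)` is scanned. -/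
def extendableCandidates (CS : CandidateSpace q G) (u : Vq) (M : List (Vq × VG)) :
    Timed (List VG) := do
  let r ← smallestNbrs CS u M
  filterTimed (fun w => isExtendable CS u w M) ((r.getD (CS.cand u)).sort (· ≤ ·))

/-- `GetRandomSubset`: a uniformly random subset of size `sz` (all of `C` if `sz` is larger), listed
in increasing order, in one step for each element of `C`. -/
def randomSubset (C : List VG) (sz : ℕ) : Prog (List VG) :=
  PMF.map (fun S : Finset VG => (S.sort (· ≤ ·), C.length))
    (PMF.uniformOfFinset (C.toFinset.powersetCard (min sz C.toFinset.card))
      (powersetCard_min_nonempty C.toFinset sz))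

/-- The integer sample size that stands for `min (c / k, ub)`, where `c` is the number of candidates:
rounded by `rd`, at least `1` and at most `c`. -/
def sampleSize (rd : ℝ → ℕ) (k : ℝ) (c : ℕ) (ub : ℝ) : ℕ :=
  max 1 (min c (rd (min ((c : ℝ) / k) ub)))

/-- The loop over `S`: `sub v b` is the recursive call for `v` with upper bound `b`, and `w`, `t`
are the running values of the estimate and of the number of trials. -/
def estimateLoop (sub : VG → ℝ → Prog (ℝ × ℕ)) (ub : ℝ) :
    List VG → ℝ → ℕ → Prog (ℝ × ℕ)
  | [], w, t => pure (w, t)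
  | v :: rest, w, t => do
    Prog.lift tick
    let r ← sub v ((ub - t) / ((rest.length : ℝ) + 1))
    estimateLoop sub ub rest (w + r.1) (t + r.2)

/-- `EstimateW`: returns the estimate of `w_M` and the number of trials.  (`M.length` never exceeds
`|V_q|`, and an unmapped vertex is always found.) -/
def estimateW (CS : CandidateSpace q G) (rd : ℝ → ℕ) (k : ℝ) (M : List (Vq × VG)) (ub : ℝ) :
    Prog (ℝ × ℕ) := do
  Prog.lift tick
  if _h : Fintype.card Vq ≤ M.length then pure (1, 1)
  else do
    match ← Prog.lift (chooseExtendableVertex CS M) with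
    | none => pure (0, 1)
    | some u => do
      let C ← Prog.lift (extendableCandidates CS u M)
      if C = [] then pure (0, 1)
      else do
        let S ← randomSubset C (sampleSize rd k C.length ub)
        let r ← estimateLoop (fun v b => estimateW CS rd k ((u, v) :: M) b) ub S 0 0
        Prog.lift tick
        pure ((C.length : ℝ) / (S.length : ℝ) * r.1, r.2)
termination_by Fintype.card Vq - M.length
decreasing_by simp only [List.length_cons]; omega

/-- `CandidateGraphSampling` with the sample size bound `ub` for the empty mapping: the joint law of
(estimate, number of trials) and the number of steps. -/
def candidateGraphSampling (CS : CandidateSpace q G) (rd : ℝ → ℕ) (k ub : ℝ) :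
    PMF ((ℝ × ℕ) × ℕ) :=
  (estimateW CS rd k [] ub).law

/-- Exhaustive backtracking along the same vertices: the number of embeddings it finds and the
number of leaves of its search tree. -/
def backtracking (CS : CandidateSpace q G) (M : List (Vq × VG)) : ℕ × ℕ :=
  if _h : Fintype.card Vq ≤ M.length then (1, 1)
  else
    match (chooseExtendableVertex CS M).1 with
    | none => (0, 1)
    | some u =>
      if (extendableCandidates CS u M).1 = [] then (0, 1)
      else ((extendableCandidates CS u M).1.map fun v => backtracking CS ((u, v) :: M)).sum
termination_by Fintype.card Vq - M.length
decreasing_by simp only [List.length_cons]; omega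

end Algorithm

/-- The estimate has mean `w` under the law `p` of (estimate, trials) and steps. -/
def IsUnbiasedFor (p : PMF ((ℝ × ℕ) × ℕ)) (w : ℝ) : Prop :=
  HasSum (fun o => (p o).toReal * o.1.1) w

end

/-!
All three parts go by induction along the recursion of `estimateW`.

*Unbiasedness.*  The candidate set `C_M(u)` contains the image of `u` under every embedding that
extends `M`, so `w_M` is the sum of `w_{M ∪ (u, v)}` over `v ∈ C_M(u)`
(`sum_numExtensions_extendableCandidates`).  Every candidate is in the same fraction of the subsets
of a given size (`sum_powersetCard_sum`), so the factor `|C_M(u)| / s` makes up for the sampling.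
The bounds passed to the calls of the loop depend on earlier random outcomes, but the mean of a call
does not depend on its bound, so the law of total expectation applies (`mean_estimateLoop`).

*Consistency.*  The numbers of trials of the exhaustive search are fixed in advance.  For `k = 1` and
a bound that exceeds what they can consume, each call samples all candidates
(`exists_forall_estimateW_eq_backtracking`), so the outcome is almost surely that of backtracking.
Being constant, the estimate agrees with its mean, the number of embeddings.

*Running time.*  For a fractional edge cover `x` let the weight `agmWeight` of a mapping `M` be
`∏ₑ |Rₑ(M)| ^ xₑ`, where `Rₑ(M)` is the part of `Rₑ` that is consistent with `M`.  By Hölder's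
inequality the weights of the extensions of `M` by one vertex add up to at most the weight of `M`
(`sum_agmWeight_cons_le`).  On the other hand the set scanned for `u` is no larger than the weight of
`M` (`card_scannedSet_le_agmWeight`): at an edge to a mapped vertex this is so because the smallest
of the sets is scanned, and at the other edges because initial candidates have neighbours with all
the labels that occur around `u`.  So each level of the recursion costs at most a polynomial in
`|V_q|` times the weight `∏ₑ |Rₑ| ^ xₑ` of the empty mapping (`steps_estimateW_le`).  This
needs all `Rₑ` to be nonempty; if one is empty then some vertex of `q` has no candidates, so the
search starts at such a vertex and stops at once.
-/

/-! ### The cost and the result of the deterministic parts -/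

theorem Timed.fst_bind {α β : Type} (x : Timed α) (f : α → Timed β) :
    (x >>= f).1 = (f x.1).1 := rfl

theorem Timed.snd_bind {α β : Type} (x : Timed α) (f : α → Timed β) :
    (x >>= f).2 = x.2 + (f x.1).2 := rfl

theorem Timed.fst_pure {α : Type} (a : α) : (pure a : Timed α).1 = a := rfl

theorem Timed.snd_pure {α : Type} (a : α) : (pure a : Timed α).2 = 0 := rfl

theorem Timed.snd_tick : Timed.tick.2 = 1 := rfl

section

set_option linter.unusedSectionVars false

variable {Vq VG Λ : Type} [Fintype Vq] [LinearOrder Vq] [Fintype VG] [LinearOrder VG]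
  {q : LabeledGraph Vq Λ} {G : LabeledGraph VG Λ}

theorem isMapped_fst (u : Vq) (M : List (Vq × VG)) :
    (isMapped u M).1 = true ↔ u ∈ M.map Prod.fst := by
  induction M with
  | nil => simp [isMapped, Timed.fst_pure]
  | cons p M ih =>
    obtain ⟨u', v'⟩ := p
    simp only [isMapped, Timed.fst_bind]
    split_ifs with h
    · simp [h, Timed.fst_pure]
    · rw [ih]; simp [h]

theorem isMapped_snd_le (u : Vq) (M : List (Vq × VG)) : (isMapped u M).2 ≤ M.length := by
  induction M with
  | nil => simp [isMapped, Timed.snd_pure]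
  | cons p M ih =>
    obtain ⟨u', v'⟩ := p
    simp only [isMapped, Timed.snd_bind, Timed.snd_tick, List.length_cons]
    split_ifs with h
    · simp [Timed.snd_pure]
    · omega

theorem mappedNeighbors_snd_le (u : Vq) (M : List (Vq × VG)) :
    (mappedNeighbors q u M).2 ≤ M.length := by
  induction M with
  | nil => simp [mappedNeighbors, Timed.snd_pure]
  | cons p M ih =>
    obtain ⟨u', v'⟩ := p
    simp only [mappedNeighbors, Timed.snd_bind, Timed.snd_tick, List.length_cons]
    split_ifs with h <;> simp only [Timed.snd_pure] <;> omega

theorem smallestVertex_snd (CS : CandidateSpace q G) (l : List Vq) :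
    (smallestVertex CS l).2 = l.length := by
  induction l with
  | nil => simp [smallestVertex, Timed.snd_pure]
  | cons u l ih =>
    simp only [smallestVertex, Timed.snd_bind, Timed.snd_tick, List.length_cons, ih]
    split
    · simp only [Timed.snd_pure]; omega
    · split_ifs <;> simp only [Timed.snd_pure] <;> omega

theorem smallestVertex_fst (CS : CandidateSpace q G) (l : List Vq) (hl : l ≠ []) :
    ∃ u, (smallestVertex CS l).1 = some u ∧ ∀ w ∈ l, (CS.cand u).card ≤ (CS.cand w).card := by
  induction l with
  | nil => exact absurd rfl hl
  | cons u l ih =>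
    simp only [smallestVertex, Timed.fst_bind]
    rcases eq_or_ne l [] with rfl | hl'
    · simp [smallestVertex, Timed.fst_pure]
    · obtain ⟨w, hw, hmin⟩ := ih hl'
      rw [hw]
      simp only
      split_ifs with h
      · refine ⟨u, rfl, ?_⟩
        intro z hz
        rcases List.mem_cons.1 hz with rfl | hz
        · exact le_rfl
        · exact h.trans (hmin z hz)
      · refine ⟨w, rfl, ?_⟩
        intro z hz
        rcases List.mem_cons.1 hz with rfl | hz
        · omega
        · exact hmin z hz

theorem mostConnectedVertex_snd_le (M : List (Vq × VG)) (l : List Vq) :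
    (mostConnectedVertex q M l).2 ≤ l.length * (1 + 2 * M.length) := by
  induction l with
  | nil => simp [mostConnectedVertex, Timed.snd_pure]
  | cons u l ih =>
    have h1 := isMapped_snd_le u M
    have h2 := mappedNeighbors_snd_le (q := q) u M
    simp only [mostConnectedVertex, Timed.snd_bind, Timed.snd_tick, List.length_cons]
    rw [add_mul l.length 1, one_mul]
    split_ifs
    · simp only [Timed.snd_pure]; omega
    · simp only [Timed.snd_bind]
      split
      · simp only [Timed.snd_pure]; omega
      · split_ifs <;> simp only [Timed.snd_pure] <;> omega

/-- The selected vertex is unmapped. -/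
theorem mostConnectedVertex_not_mem (M : List (Vq × VG)) (l : List Vq) (r : Vq × ℕ)
    (h : (mostConnectedVertex q M l).1 = some r) : r.1 ∉ M.map Prod.fst := by
  induction l generalizing r with
  | nil => simp [mostConnectedVertex, Timed.fst_pure] at h
  | cons u l ih =>
    simp only [mostConnectedVertex, Timed.fst_bind] at h
    split_ifs at h with hb
    · exact ih r h
    · have hu : u ∉ M.map Prod.fst := fun hu => hb ((isMapped_fst u M).2 hu)
      simp only [Timed.fst_bind] at h
      split at h
      · simp only [Timed.fst_pure, Option.some.injEq] at h
        subst h; exact hu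
      · rename_i w m hw
        split_ifs at h
        · simp only [Timed.fst_pure, Option.some.injEq] at h
          subst h; exact hu
        · simp only [Timed.fst_pure, Option.some.injEq] at h
          subst h; exact ih _ hw

theorem mostConnectedVertex_ne_none (M : List (Vq × VG)) (l : List Vq)
    (hl : ∃ u ∈ l, u ∉ M.map Prod.fst) : (mostConnectedVertex q M l).1 ≠ none := by
  induction l with
  | nil => simp at hl
  | cons u l ih =>
    simp only [mostConnectedVertex, Timed.fst_bind]
    split_ifs with hb
    · rw [isMapped_fst] at hb
      obtain ⟨z, hz, hzM⟩ := hl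
      rcases List.mem_cons.1 hz with rfl | hz
      · exact absurd hb hzM
      · exact ih ⟨z, hz, hzM⟩
    · simp only [Timed.fst_bind]
      split
      · simp [Timed.fst_pure]
      · split_ifs <;> simp [Timed.fst_pure]

/-- As long as `M` is not total, an unmapped vertex is found. -/
theorem exists_chooseExtendableVertex (CS : CandidateSpace q G) (M : List (Vq × VG))
    (hM : M.length < Fintype.card Vq) :
    ∃ u, (chooseExtendableVertex CS M).1 = some u ∧ u ∉ M.map Prod.fst := by
  unfold chooseExtendableVertex
  split_ifs with h
  · subst h
    have hne : (Finset.univ : Finset Vq).sort (· ≤ ·) ≠ [] := by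
      intro h0
      have := congrArg List.length h0
      simp only [Finset.length_sort, Finset.card_univ, List.length_nil] at this
      simp only [List.length_nil] at hM
      omega
    obtain ⟨u, hu, -⟩ := smallestVertex_fst CS _ hne
    exact ⟨u, hu, by simp⟩
  · have hex : ∃ u, u ∉ M.map Prod.fst := by
      by_contra! hall
      have h1 : (Finset.univ : Finset Vq) ⊆ (M.map Prod.fst).toFinset := fun u _ => by
        simpa using hall u
      have h2 := (Finset.card_le_card h1).trans (List.toFinset_card_le _)
      simp only [Finset.card_univ, List.length_map] at h2
      omega
    obtain ⟨u, hu⟩ := hex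
    have := mostConnectedVertex_ne_none (q := q) M ((Finset.univ : Finset Vq).sort (· ≤ ·))
      ⟨u, by simp, hu⟩
    obtain ⟨r, hr⟩ := Option.ne_none_iff_exists'.1 this
    refine ⟨r.1, ?_, mostConnectedVertex_not_mem M _ r hr⟩
    simp [Timed.fst_bind, Timed.fst_pure, hr]

theorem chooseExtendableVertex_snd_le (CS : CandidateSpace q G) (M : List (Vq × VG)) :
    (chooseExtendableVertex CS M).2 ≤ Fintype.card Vq * (1 + 2 * M.length) := by
  unfold chooseExtendableVertex
  split_ifs with h
  · subst h
    simp [smallestVertex_snd]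
  · have := mostConnectedVertex_snd_le (q := q) M ((Finset.univ : Finset Vq).sort (· ≤ ·))
    simpa [Timed.snd_bind, Timed.snd_pure] using this

open scoped Classical in
theorem smallestNbrs_snd_le (CS : CandidateSpace q G) (u : Vq) (M : List (Vq × VG)) :
    (smallestNbrs CS u M).2 ≤ 2 * M.length := by
  induction M with
  | nil => simp [smallestNbrs, Timed.snd_pure]
  | cons p M ih =>
    obtain ⟨u', v'⟩ := p
    simp only [smallestNbrs, Timed.snd_bind, Timed.snd_tick, List.length_cons]
    split_ifs with h
    · simp only [Timed.snd_bind, Timed.snd_tick]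
      split
      · simp only [Timed.snd_pure]; omega
      · split_ifs <;> simp only [Timed.snd_pure] <;> omega
    · simp only [Timed.snd_pure]; omega

theorem smallestNbrs_eq_none (CS : CandidateSpace q G) (u : Vq) (M : List (Vq × VG))
    (h : (smallestNbrs CS u M).1 = none) : ∀ p ∈ M, ¬ q.graph.Adj u p.1 := by
  induction M with
  | nil => simp
  | cons p M ih =>
    obtain ⟨u', v'⟩ := p
    simp only [smallestNbrs, Timed.fst_bind] at h
    split_ifs at h with ha
    · simp only [Timed.fst_bind] at h
      split at h
      · simp [Timed.fst_pure] at h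
      · split_ifs at h
    · intro p hp
      rcases List.mem_cons.1 hp with rfl | hp
      · exact ha
      · exact ih h p hp

theorem smallestNbrs_eq_some (CS : CandidateSpace q G) (u : Vq) (M : List (Vq × VG))
    (A : Finset VG) (h : (smallestNbrs CS u M).1 = some A) :
    (∃ p ∈ M, q.graph.Adj u p.1 ∧ A = CS.nbrs u p.1 p.2) ∧
      ∀ p ∈ M, q.graph.Adj u p.1 → A.card ≤ (CS.nbrs u p.1 p.2).card := by
  induction M generalizing A with
  | nil => simp [smallestNbrs, Timed.fst_pure] at h
  | cons p M ih =>
    obtain ⟨u', v'⟩ := p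
    simp only [smallestNbrs, Timed.fst_bind] at h
    split_ifs at h with hadj
    · simp only [Timed.fst_bind] at h
      split at h
      · rename_i hn
        simp only [Timed.fst_pure, Option.some.injEq] at h
        subst h
        refine ⟨⟨(u', v'), by simp, hadj, rfl⟩, ?_⟩
        intro p hp hpadj
        rcases List.mem_cons.1 hp with rfl | hp
        · exact le_rfl
        · exact absurd hpadj (smallestNbrs_eq_none CS u M hn p hp)
      · rename_i B hB
        obtain ⟨⟨p0, hp0, h1, h2⟩, h3⟩ := ih B hB
        split_ifs at h with hle
        · simp only [Timed.fst_pure, Option.some.injEq] at h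
          subst h
          refine ⟨⟨(u', v'), by simp, hadj, rfl⟩, ?_⟩
          intro p hp hpadj
          rcases List.mem_cons.1 hp with rfl | hp
          · exact le_rfl
          · exact hle.trans (h3 p hp hpadj)
        · simp only [Timed.fst_pure, Option.some.injEq] at h
          subst h
          refine ⟨⟨p0, by simp [hp0], h1, h2⟩, ?_⟩
          intro p hp hpadj
          rcases List.mem_cons.1 hp with rfl | hp
          · exact (not_le.1 hle).le
          · exact h3 p hp hpadj
    · obtain ⟨⟨p0, hp0, h1, h2⟩, h3⟩ := ih A h
      refine ⟨⟨p0, by simp [hp0], h1, h2⟩, ?_⟩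
      intro p hp hpadj
      rcases List.mem_cons.1 hp with rfl | hp
      · exact absurd hpadj hadj
      · exact h3 p hp hpadj

theorem isExtendable_fst (CS : CandidateSpace q G) (u : Vq) (w : VG) (M : List (Vq × VG)) :
    (isExtendable CS u w M).1 = true ↔
      ∀ p ∈ M, w ≠ p.2 ∧ (q.graph.Adj u p.1 → w ∈ CS.nbrs u p.1 p.2) := by
  induction M with
  | nil => simp [isExtendable, Timed.fst_pure]
  | cons p M ih =>
    obtain ⟨u', v'⟩ := p
    simp only [isExtendable, Timed.fst_bind, List.forall_mem_cons]
    split_ifs with h1 h2 h3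
    · simp [h1]
    · simp only [Timed.fst_bind]
      rw [ih]
      simp [h1, h3]
    · simp [h2, h3]
    · simp only [Timed.fst_bind]
      rw [ih]
      simp [h1, h2]

theorem isExtendable_snd_le (CS : CandidateSpace q G) (u : Vq) (w : VG) (M : List (Vq × VG)) :
    (isExtendable CS u w M).2 ≤ 3 * M.length := by
  induction M with
  | nil => simp [isExtendable, Timed.snd_pure]
  | cons p M ih =>
    obtain ⟨u', v'⟩ := p
    simp only [isExtendable, Timed.snd_bind, Timed.snd_tick, List.length_cons]
    split_ifs <;> simp only [Timed.snd_bind, Timed.snd_tick, Timed.snd_pure] <;> omega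

theorem filterTimed_fst (p : VG → Timed Bool) (l : List VG) :
    (filterTimed p l).1 = l.filter fun w => (p w).1 := by
  induction l with
  | nil => simp [filterTimed, Timed.fst_pure]
  | cons w l ih =>
    simp only [filterTimed, Timed.fst_bind, List.filter_cons]
    split_ifs <;> simp [Timed.fst_pure, ih]

theorem filterTimed_snd_le (p : VG → Timed Bool) (l : List VG) (b : ℕ) (hb : ∀ w, (p w).2 ≤ b) :
    (filterTimed p l).2 ≤ l.length * (1 + b) := by
  induction l with
  | nil => simp [filterTimed, Timed.snd_pure]
  | cons w l ih =>
    have := hb w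
    simp only [filterTimed, Timed.snd_bind, Timed.snd_tick, List.length_cons, add_mul, one_mul]
    split_ifs <;> simp only [Timed.snd_pure] <;> omega

/-- The set that is scanned by the multi-way intersection. -/
noncomputable def scannedSet (CS : CandidateSpace q G) (u : Vq) (M : List (Vq × VG)) : Finset VG :=
  (smallestNbrs CS u M).1.getD (CS.cand u)

theorem extendableCandidates_fst (CS : CandidateSpace q G) (u : Vq) (M : List (Vq × VG)) :
    (extendableCandidates CS u M).1 =
      ((scannedSet CS u M).sort (· ≤ ·)).filter fun w => (isExtendable CS u w M).1 := by
  simp only [extendableCandidates, Timed.fst_bind, filterTimed_fst]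
  rfl

theorem nodup_extendableCandidates (CS : CandidateSpace q G) (u : Vq) (M : List (Vq × VG)) :
    (extendableCandidates CS u M).1.Nodup := by
  rw [extendableCandidates_fst]
  exact (Finset.sort_nodup _ _).filter _

theorem mem_extendableCandidates (CS : CandidateSpace q G) (u : Vq) (M : List (Vq × VG))
    (w : VG) : w ∈ (extendableCandidates CS u M).1 ↔ w ∈ scannedSet CS u M ∧
      ∀ p ∈ M, w ≠ p.2 ∧ (q.graph.Adj u p.1 → w ∈ CS.nbrs u p.1 p.2) := by
  rw [extendableCandidates_fst, List.mem_filter, Finset.mem_sort, isExtendable_fst]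

theorem length_extendableCandidates_le (CS : CandidateSpace q G) (u : Vq) (M : List (Vq × VG)) :
    (extendableCandidates CS u M).1.length ≤ (scannedSet CS u M).card := by
  rw [extendableCandidates_fst]
  exact (List.length_filter_le _ _).trans (by simp)

theorem extendableCandidates_snd_le (CS : CandidateSpace q G) (u : Vq) (M : List (Vq × VG)) :
    (extendableCandidates CS u M).2 ≤
      2 * M.length + (scannedSet CS u M).card * (1 + 3 * M.length) := by
  simp only [extendableCandidates, Timed.snd_bind]
  refine add_le_add (smallestNbrs_snd_le CS u M) ?_
  refine (filterTimed_snd_le _ _ (3 * M.length) fun w => isExtendable_snd_le CS u w M).trans ?_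
  rw [Finset.length_sort]
  rfl

theorem mem_nbrs (CS : CandidateSpace q G) (u u' : Vq) (v' w : VG) :
    w ∈ CS.nbrs u u' v' ↔ (v', w) ∈ CS.edges u' u := by
  simp [CandidateSpace.nbrs]

/-- Both candidate vertices and endpoints of candidate edges are initial candidates. -/
theorem scannedSet_subset_initialCand (CS : CandidateSpace q G) (u : Vq) (M : List (Vq × VG))
    {w : VG} (hw : w ∈ scannedSet CS u M) : w ∈ initialCand q G u := by
  unfold scannedSet at hw
  rcases hA : (smallestNbrs CS u M).1 with _ | A
  · rw [hA] at hw
    exact CS.cand_initial u w hw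
  · rw [hA] at hw
    obtain ⟨⟨p, -, hadj, rfl⟩, -⟩ := smallestNbrs_eq_some CS u M A hA
    exact (CS.edges_initial p.1 u hadj.symm _ ((mem_nbrs CS u p.1 p.2 w).1 hw)).2.2

theorem card_scannedSet_le (CS : CandidateSpace q G) (u : Vq) (M : List (Vq × VG))
    {p : Vq × VG} (hp : p ∈ M) (hadj : q.graph.Adj u p.1) :
    (scannedSet CS u M).card ≤ (CS.nbrs u p.1 p.2).card := by
  unfold scannedSet
  rcases hA : (smallestNbrs CS u M).1 with _ | A
  · exact absurd hadj (smallestNbrs_eq_none CS u M hA p hp)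
  · exact (smallestNbrs_eq_some CS u M A hA).2 p hp hadj

/-- No embedding that extends `M` is lost. -/
theorem apply_mem_extendableCandidates (CS : CandidateSpace q G) {u : Vq} {M : List (Vq × VG)}
    (hu : u ∉ M.map Prod.fst) {f : Vq → VG} (hf : IsEmbedding q G f)
    (hfM : ∀ p ∈ M, f p.1 = p.2) : f u ∈ (extendableCandidates CS u M).1 := by
  have hn : ∀ p ∈ M, q.graph.Adj u p.1 → f u ∈ CS.nbrs u p.1 p.2 := by
    intro p hp hadj
    rw [mem_nbrs, ← hfM p hp]
    exact CS.edges_complete f hf p.1 u hadj.symm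
  rw [mem_extendableCandidates]
  refine ⟨?_, fun p hp => ⟨?_, hn p hp⟩⟩
  · unfold scannedSet
    rcases hA : (smallestNbrs CS u M).1 with _ | A
    · exact CS.cand_complete f hf u
    · obtain ⟨⟨p, hp, hadj, rfl⟩, -⟩ := smallestNbrs_eq_some CS u M A hA
      exact hn p hp hadj
  · rw [← hfM p hp]
    intro h
    have := hf.injective h
    exact hu (List.mem_map.2 ⟨p, hp, this.symm⟩)

theorem IsPartialEmbedding.cons_extendableCandidates {CS : CandidateSpace q G} {u : Vq}
    {M : List (Vq × VG)} (hM : IsPartialEmbedding q G M) (hu : u ∉ M.map Prod.fst) {v : VG}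
    (hv : v ∈ (extendableCandidates CS u M).1) : IsPartialEmbedding q G ((u, v) :: M) := by
  rw [mem_extendableCandidates] at hv
  obtain ⟨hv1, hv2⟩ := hv
  have hadj : ∀ p ∈ M, q.graph.Adj u p.1 → G.graph.Adj v p.2 := fun p hp h =>
    (CS.edges_initial p.1 u h.symm _ ((mem_nbrs CS u p.1 p.2 v).1 ((hv2 p hp).2 h))).1.symm
  refine ⟨?_, ?_, ?_, ?_⟩
  · simpa using ⟨by simpa using hu, hM.functional⟩
  · rw [List.map_cons, List.nodup_cons]
    refine ⟨?_, hM.injective⟩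
    rw [List.mem_map]
    rintro ⟨p, hp, h⟩
    exact (hv2 p hp).1 h.symm
  · intro p hp p' hp' h
    rcases List.mem_cons.1 hp with rfl | hp <;> rcases List.mem_cons.1 hp' with rfl | hp'
    · exact absurd h (q.graph.irrefl)
    · exact hadj p' hp' h
    · exact (hadj p hp h.symm).symm
    · exact hM.adj p hp p' hp' h
  · intro p hp
    rcases List.mem_cons.1 hp with rfl | hp
    · exact (scannedSet_subset_initialCand CS u M hv1).1
    · exact hM.label p hp

/-! ### Counting the embeddings that extend a mapping -/

theorem numExtensions_nil : numExtensions q G [] = numEmbeddings q G := by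
  simp [numExtensions, numEmbeddings]

/-- A partial embedding of full length has exactly one extension, namely itself. -/
theorem numExtensions_of_card_le {M : List (Vq × VG)} (hM : IsPartialEmbedding q G M)
    (hlen : Fintype.card Vq ≤ M.length) : numExtensions q G M = 1 := by
  have hall : ∀ u, ∃ v, (u, v) ∈ M := by
    intro u
    have h1 : (M.map Prod.fst).toFinset = Finset.univ := by
      refine Finset.eq_univ_of_card _ (le_antisymm (Finset.card_le_univ _) ?_)
      rw [List.toFinset_card_of_nodup hM.functional, List.length_map]
      exact hlen
    have h2 : u ∈ (M.map Prod.fst).toFinset := by rw [h1]; exact Finset.mem_univ u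
    simpa using h2
  choose f hf using hall
  have hfM : ∀ p ∈ M, f p.1 = p.2 := by
    intro p hp
    exact congrArg Prod.snd (List.inj_on_of_nodup_map hM.functional (hf p.1) hp rfl)
  have hemb : IsEmbedding q G f := by
    refine ⟨?_, fun u u' h => hM.adj _ (hf u) _ (hf u') h, fun u => hM.label _ (hf u)⟩
    intro u u' h
    exact congrArg Prod.fst (List.inj_on_of_nodup_map hM.injective (hf u) (hf u') h)
  rw [numExtensions, Nat.card_eq_one_iff_unique]
  refine ⟨⟨?_⟩, ⟨⟨f, hemb, hfM⟩⟩⟩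
  rintro ⟨g, -, hg⟩ ⟨g', -, hg'⟩
  ext u
  exact (hg _ (hf u)).trans (hg' _ (hf u)).symm

theorem sum_numExtensions_extendableCandidates (CS : CandidateSpace q G) {u : Vq}
    {M : List (Vq × VG)} (hu : u ∉ M.map Prod.fst) :
    ∑ v ∈ (extendableCandidates CS u M).1.toFinset, numExtensions q G ((u, v) :: M) =
      numExtensions q G M := by
  classical
  have hcard : ∀ M' : List (Vq × VG), numExtensions q G M' =
      (Finset.univ.filter fun f : Vq → VG =>
        IsEmbedding q G f ∧ ∀ p ∈ M', f p.1 = p.2).card := by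
    intro M'
    rw [numExtensions, Nat.card_eq_fintype_card, Fintype.card_subtype]
  rw [hcard M, Finset.card_eq_sum_card_fiberwise (f := fun f => f u)
    (t := (extendableCandidates CS u M).1.toFinset)]
  · refine Finset.sum_congr rfl fun v _ => ?_
    rw [hcard, Finset.filter_filter]
    congr 1
    ext f
    simp only [Finset.mem_filter, Finset.mem_univ, true_and, List.forall_mem_cons]
    tauto
  · intro f hf
    simp only [Finset.coe_filter, Finset.mem_univ, true_and, Set.mem_ofPred_eq] at hf
    simpa using apply_mem_extendableCandidates CS hu hf.1 hf.2

end

/-! ### Means and supports of randomized programs -/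

open scoped ENNReal

/-- The mean of `g` of the result of a randomized computation.  It is taken in `[0, ∞]`, where the
law of total expectation holds without any integrability condition. -/
noncomputable def Prog.mean {α : Type} (p : Prog α) (g : α → ℝ≥0∞) : ℝ≥0∞ :=
  ∑' o, p.law o * g o.1

theorem PMF.tsum_bind_mul {α β : Type} (p : PMF α) (f : α → PMF β) (g : β → ℝ≥0∞) :
    ∑' b, (p.bind f) b * g b = ∑' a, p a * ∑' b, f a b * g b := by
  simp only [PMF.bind_apply, ← ENNReal.tsum_mul_right, ← ENNReal.tsum_mul_left]
  rw [ENNReal.tsum_comm]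
  simp only [mul_assoc]

theorem PMF.tsum_pure_mul {β : Type} (b : β) (g : β → ℝ≥0∞) :
    ∑' b', (PMF.pure b) b' * g b' = g b := by
  rw [tsum_eq_single b]
  · simp
  · intro b' hb'
    simp [PMF.pure_apply, hb']

theorem PMF.tsum_map_mul {α β : Type} (p : PMF α) (f : α → β) (g : β → ℝ≥0∞) :
    ∑' b, (p.map f) b * g b = ∑' a, p a * g (f a) := by
  rw [← PMF.bind_pure_comp, PMF.tsum_bind_mul]
  simp only [Function.comp_apply, PMF.tsum_pure_mul]

theorem Prog.mean_pure {α : Type} (a : α) (g : α → ℝ≥0∞) : (pure a : Prog α).mean g = g a :=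
  PMF.tsum_pure_mul (a, 0) fun o => g o.1

theorem Prog.mean_lift {α : Type} (x : Timed α) (g : α → ℝ≥0∞) :
    (Prog.lift x).mean g = g x.1 :=
  PMF.tsum_pure_mul x fun o => g o.1

theorem Prog.mean_bind {α β : Type} (x : Prog α) (f : α → Prog β) (g : β → ℝ≥0∞) :
    (x >>= f).mean g = x.mean fun a => (f a).mean g := by
  refine (PMF.tsum_bind_mul x.law
    (fun r => PMF.map (fun s => (s.1, r.2 + s.2)) (f r.1).law) fun o => g o.1).trans ?_
  simp only [PMF.tsum_map_mul]
  rfl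

theorem Prog.mean_congr {α : Type} (x : Prog α) {g g' : α → ℝ≥0∞}
    (h : ∀ o ∈ x.law.support, g o.1 = g' o.1) : x.mean g = x.mean g' := by
  refine tsum_congr fun o => ?_
  by_cases ho : o ∈ x.law.support
  · rw [h o ho]
  · rw [PMF.mem_support_iff, not_not] at ho
    simp [ho]

theorem Prog.mean_const_add {α : Type} (x : Prog α) (c : ℝ≥0∞) (g : α → ℝ≥0∞) :
    (x.mean fun a => c + g a) = c + x.mean g := by
  rw [Prog.mean]
  simp only [mul_add]
  rw [ENNReal.tsum_add, ENNReal.tsum_mul_right, PMF.tsum_coe, one_mul]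
  rfl

theorem Prog.mean_const_mul {α : Type} (x : Prog α) (c : ℝ≥0∞) (g : α → ℝ≥0∞) :
    (x.mean fun a => c * g a) = c * x.mean g := by
  rw [Prog.mean, Prog.mean, ← ENNReal.tsum_mul_left]
  exact tsum_congr fun o => by ring

theorem Prog.mem_support_pure {α : Type} (a : α) (o : α × ℕ) :
    o ∈ (pure a : Prog α).law.support ↔ o = (a, 0) :=
  PMF.mem_support_pure_iff (a, 0) o

theorem Prog.mem_support_lift {α : Type} (x : Timed α) (o : α × ℕ) :
    o ∈ (Prog.lift x).law.support ↔ o = x :=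
  PMF.mem_support_pure_iff x o

theorem Prog.mem_support_bind {α β : Type} (x : Prog α) (f : α → Prog β) (o : β × ℕ) :
    o ∈ (x >>= f).law.support ↔
      ∃ r ∈ x.law.support, ∃ s ∈ (f r.1).law.support, o = (s.1, r.2 + s.2) := by
  refine (PMF.mem_support_bind_iff x.law
    (fun r => PMF.map (fun s => (s.1, r.2 + s.2)) (f r.1).law) o).trans ?_
  simp only [PMF.mem_support_map_iff, eq_comm (a := o)]

theorem Prog.mem_support_lift_bind {α β : Type} (x : Timed α) (f : α → Prog β) (o : β × ℕ) :
    o ∈ (Prog.lift x >>= f).law.support ↔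
      ∃ s ∈ (f x.1).law.support, o = (s.1, x.2 + s.2) := by
  rw [Prog.mem_support_bind]
  constructor
  · rintro ⟨r, hr, h⟩
    rw [Prog.mem_support_lift] at hr
    exact hr ▸ h
  · exact fun h => ⟨x, (Prog.mem_support_lift x x).2 rfl, h⟩

theorem Prog.lift_bind_congr {α β : Type} (x : Timed α) {f g : α → Prog β} (h : f x.1 = g x.1) :
    (Prog.lift x >>= f) = (Prog.lift x >>= g) := by
  refine ((PMF.pure_bind x _).trans ?_).trans (PMF.pure_bind x _).symm
  simp only [h]

theorem isUnbiasedFor_of_mean {p : Prog (ℝ × ℕ)} {w : ℕ}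
    (hnonneg : ∀ o ∈ p.law.support, 0 ≤ o.1.1)
    (hmean : (p.mean fun r => ENNReal.ofReal r.1) = w) : IsUnbiasedFor p.law w := by
  have h : ∀ o, (p.law o).toReal * o.1.1 = (p.law o * ENNReal.ofReal o.1.1).toReal := by
    intro o
    by_cases ho : o ∈ p.law.support
    · rw [ENNReal.toReal_mul, ENNReal.toReal_ofReal (hnonneg o ho)]
    · rw [PMF.mem_support_iff, not_not] at ho
      simp [ho]
  have hne : ∑' o, p.law o * ENNReal.ofReal o.1.1 ≠ ∞ := by
    change (p.mean fun r => ENNReal.ofReal r.1) ≠ ∞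
    rw [hmean]
    exact ENNReal.natCast_ne_top w
  have hs := ENNReal.hasSum_toReal hne
  rw [IsUnbiasedFor]
  simp only [h]
  convert hs using 1
  rw [← ENNReal.tsum_toReal_eq (ENNReal.ne_top_of_tsum_ne_top hne)]
  change _ = (p.mean fun r => ENNReal.ofReal r.1).toReal
  rw [hmean, ENNReal.toReal_natCast]

/-- A mean of a quantity that is almost surely constant is that constant. -/
theorem eq_of_isUnbiasedFor {p : PMF ((ℝ × ℕ) × ℕ)} {w a : ℝ} (h : IsUnbiasedFor p w)
    (ha : ∀ o ∈ p.support, o.1.1 = a) : a = w := by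
  have h1 : ∀ o, (p o).toReal * o.1.1 = (p o).toReal * a := by
    intro o
    by_cases ho : o ∈ p.support
    · rw [ha o ho]
    · rw [PMF.mem_support_iff, not_not] at ho
      simp [ho]
  have h2 : HasSum (fun o => (p o).toReal) 1 := by
    have := ENNReal.hasSum_toReal p.tsum_coe_ne_top
    rwa [← ENNReal.tsum_toReal_eq (fun o => p.apply_ne_top o), p.tsum_coe,
      ENNReal.toReal_one] at this
  have h3 := h2.mul_right a
  rw [one_mul] at h3
  rw [IsUnbiasedFor] at h
  simp only [h1] at h
  exact h3.unique h

/-- Every element lies in the same fraction of the subsets of a given size. -/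
theorem sum_powersetCard_sum {ι : Type} [DecidableEq ι] (C : Finset ι) (f : ι → ℝ≥0∞) {s : ℕ}
    (hs : 0 < s) :
    C.card * ∑ S ∈ C.powersetCard s, ∑ i ∈ S, f i =
      s * (C.powersetCard s).card * ∑ i ∈ C, f i := by
  have h1 : ∀ i ∈ C, (((C.powersetCard s).filter fun S => i ∈ S).card : ℝ≥0∞) * C.card =
      s * (C.powersetCard s).card := by
    intro i hi
    have h2 : ((C.powersetCard s).filter fun S => i ∈ S).card = (C.card - 1).choose (s - 1) := by
      rw [← Finset.card_erase_of_mem hi, ← Finset.card_powersetCard]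
      refine Finset.card_bij' (fun S _ => S.erase i) (fun S _ => insert i S) ?_ ?_ ?_ ?_
      · intro S hS
        rw [Finset.mem_filter, Finset.mem_powersetCard] at hS
        rw [Finset.mem_powersetCard, Finset.card_erase_of_mem hS.2, hS.1.2]
        exact ⟨Finset.erase_subset_erase _ hS.1.1, rfl⟩
      · intro S hS
        rw [Finset.mem_powersetCard] at hS
        have hiS : i ∉ S := fun h => Finset.notMem_erase i C (hS.1 h)
        rw [Finset.mem_filter, Finset.mem_powersetCard, Finset.card_insert_of_notMem hiS, hS.2]
        refine ⟨⟨Finset.insert_subset hi (hS.1.trans (Finset.erase_subset _ _)), by omega⟩, ?_⟩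
        exact Finset.mem_insert_self _ _
      · intro S hS
        rw [Finset.mem_filter] at hS
        exact Finset.insert_erase hS.2
      · intro S hS
        rw [Finset.mem_powersetCard] at hS
        exact Finset.erase_insert fun h => Finset.notMem_erase i C (hS.1 h)
    have hC : 0 < C.card := Finset.card_pos.2 ⟨i, hi⟩
    rw [h2, Finset.card_powersetCard]
    have h3 := Nat.add_one_mul_choose_eq (C.card - 1) (s - 1)
    rw [Nat.sub_add_cancel hC, Nat.sub_add_cancel hs] at h3
    have h4 : (C.card - 1).choose (s - 1) * C.card = s * C.card.choose s := by
      rw [mul_comm, h3, mul_comm]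
    exact_mod_cast h4
  have h2 : ∑ S ∈ C.powersetCard s, ∑ i ∈ S, f i =
      ∑ i ∈ C, ((C.powersetCard s).filter fun S => i ∈ S).card * f i := by
    rw [Finset.sum_comm' (t' := C) (s' := fun i => (C.powersetCard s).filter fun S => i ∈ S)]
    · simp
    · intro S i
      simp only [Finset.mem_filter]
      constructor
      · rintro ⟨h, hi⟩
        exact ⟨⟨h, hi⟩, (Finset.mem_powersetCard.1 h).1 hi⟩
      · rintro ⟨⟨h, hi⟩, -⟩
        exact ⟨h, hi⟩
  rw [h2, Finset.mul_sum, Finset.mul_sum]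
  refine Finset.sum_congr rfl fun i hi => ?_
  rw [← h1 i hi]
  ring

/-! ### One call of the recursion -/

section

set_option linter.unusedSectionVars false

variable {Vq VG Λ : Type} [Fintype Vq] [LinearOrder Vq] [Fintype VG] [LinearOrder VG]
  {q : LabeledGraph Vq Λ} {G : LabeledGraph VG Λ}

theorem mem_support_randomSubset (C : List VG) (sz : ℕ) (o : List VG × ℕ) :
    o ∈ (randomSubset C sz).law.support ↔
      ∃ S ∈ C.toFinset.powersetCard (min sz C.toFinset.card),
        o = (S.sort (· ≤ ·), C.length) := by
  refine (PMF.mem_support_map_iff _ _ o).trans ?_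
  simp only [PMF.mem_support_uniformOfFinset_iff, eq_comm (a := o)]

theorem mean_randomSubset (C : List VG) (sz : ℕ) (g : List VG → ℝ≥0∞) :
    (randomSubset C sz).mean g =
      ((C.toFinset.powersetCard (min sz C.toFinset.card)).card : ℝ≥0∞)⁻¹ *
        ∑ S ∈ C.toFinset.powersetCard (min sz C.toFinset.card), g (S.sort (· ≤ ·)) := by
  refine (PMF.tsum_map_mul (PMF.uniformOfFinset _ (powersetCard_min_nonempty C.toFinset sz))
    (fun S : Finset VG => (S.sort (· ≤ ·), C.length)) fun o => g o.1).trans ?_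
  rw [tsum_eq_sum (s := C.toFinset.powersetCard (min sz C.toFinset.card))]
  · rw [Finset.mul_sum]
    refine Finset.sum_congr rfl fun S hS => ?_
    rw [PMF.uniformOfFinset_apply_of_mem _ hS]
  · intro S hS
    rw [PMF.uniformOfFinset_apply_of_notMem _ hS, zero_mul]

theorem estimateW_of_card_le (CS : CandidateSpace q G) (rd : ℝ → ℕ) (k ub : ℝ)
    (M : List (Vq × VG)) (h : Fintype.card Vq ≤ M.length) :
    estimateW CS rd k M ub = (Prog.lift Timed.tick >>= fun _ => pure (1, 1)) := by
  rw [estimateW]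
  simp only [dif_pos h]

theorem estimateW_of_eq_nil (CS : CandidateSpace q G) (rd : ℝ → ℕ) (k ub : ℝ)
    (M : List (Vq × VG)) (h : M.length < Fintype.card Vq) {u : Vq}
    (hu : (chooseExtendableVertex CS M).1 = some u) (hC : (extendableCandidates CS u M).1 = []) :
    estimateW CS rd k M ub = (Prog.lift Timed.tick >>= fun _ =>
      Prog.lift (chooseExtendableVertex CS M) >>= fun _ =>
      Prog.lift (extendableCandidates CS u M) >>= fun _ => pure (0, 1)) := by
  rw [estimateW]
  simp only [dif_neg (not_le.2 h)]
  refine Prog.lift_bind_congr _ (Prog.lift_bind_congr _ ?_)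
  rw [hu]
  refine Prog.lift_bind_congr _ ?_
  rw [hC, if_pos rfl]

theorem estimateW_of_ne_nil (CS : CandidateSpace q G) (rd : ℝ → ℕ) (k ub : ℝ)
    (M : List (Vq × VG)) (h : M.length < Fintype.card Vq) {u : Vq}
    (hu : (chooseExtendableVertex CS M).1 = some u) (hC : (extendableCandidates CS u M).1 ≠ []) :
    estimateW CS rd k M ub = (Prog.lift Timed.tick >>= fun _ =>
      Prog.lift (chooseExtendableVertex CS M) >>= fun _ =>
      Prog.lift (extendableCandidates CS u M) >>= fun _ =>
      randomSubset (extendableCandidates CS u M).1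
        (sampleSize rd k (extendableCandidates CS u M).1.length ub) >>= fun S =>
      estimateLoop (fun v b => estimateW CS rd k ((u, v) :: M) b) ub S 0 0 >>= fun r =>
      Prog.lift Timed.tick >>= fun _ =>
      pure (((extendableCandidates CS u M).1.length : ℝ) / (S.length : ℝ) * r.1, r.2)) := by
  rw [estimateW]
  simp only [dif_neg (not_le.2 h)]
  refine Prog.lift_bind_congr _ (Prog.lift_bind_congr _ ?_)
  rw [hu]
  refine Prog.lift_bind_congr _ ?_
  rw [if_neg hC]

theorem mem_support_estimateW_of_card_le (CS : CandidateSpace q G) (rd : ℝ → ℕ) (k ub : ℝ)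
    (M : List (Vq × VG)) (h : Fintype.card Vq ≤ M.length) {o : (ℝ × ℕ) × ℕ}
    (ho : o ∈ (estimateW CS rd k M ub).law.support) : o = ((1, 1), 1) := by
  rw [estimateW_of_card_le CS rd k ub M h, Prog.mem_support_lift_bind] at ho
  obtain ⟨s, hs, rfl⟩ := ho
  rw [Prog.mem_support_pure] at hs
  rw [hs]
  rfl

theorem mem_support_estimateW_of_eq_nil (CS : CandidateSpace q G) (rd : ℝ → ℕ) (k ub : ℝ)
    (M : List (Vq × VG)) (h : M.length < Fintype.card Vq) {u : Vq}
    (hu : (chooseExtendableVertex CS M).1 = some u) (hC : (extendableCandidates CS u M).1 = [])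
    {o : (ℝ × ℕ) × ℕ} (ho : o ∈ (estimateW CS rd k M ub).law.support) :
    o = ((0, 1), 1 + (chooseExtendableVertex CS M).2 + (extendableCandidates CS u M).2) := by
  rw [estimateW_of_eq_nil CS rd k ub M h hu hC] at ho
  simp only [Prog.mem_support_lift_bind, Prog.mem_support_pure] at ho
  obtain ⟨_, ⟨_, ⟨_, rfl, rfl⟩, rfl⟩, rfl⟩ := ho
  simp only [Timed.snd_tick, add_zero, add_assoc]

theorem mem_support_estimateW_of_ne_nil (CS : CandidateSpace q G) (rd : ℝ → ℕ) (k ub : ℝ)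
    (M : List (Vq × VG)) (h : M.length < Fintype.card Vq) {u : Vq}
    (hu : (chooseExtendableVertex CS M).1 = some u) (hC : (extendableCandidates CS u M).1 ≠ [])
    {o : (ℝ × ℕ) × ℕ} (ho : o ∈ (estimateW CS rd k M ub).law.support) :
    ∃ S ∈ (extendableCandidates CS u M).1.toFinset.powersetCard
        (min (sampleSize rd k (extendableCandidates CS u M).1.length ub)
          (extendableCandidates CS u M).1.toFinset.card),
      ∃ r ∈ (estimateLoop (fun v b => estimateW CS rd k ((u, v) :: M) b) ub
        (S.sort (· ≤ ·)) 0 0).law.support,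
      o = ((((extendableCandidates CS u M).1.length : ℝ) / (S.card : ℝ) * r.1.1, r.1.2),
        1 + (chooseExtendableVertex CS M).2 + (extendableCandidates CS u M).2 +
          (extendableCandidates CS u M).1.length + r.2 + 1) := by
  rw [estimateW_of_ne_nil CS rd k ub M h hu hC] at ho
  simp only [Prog.mem_support_bind, Prog.mem_support_lift, Prog.mem_support_pure,
    mem_support_randomSubset] at ho
  obtain ⟨_, rfl, _, ⟨_, rfl, _, ⟨_, rfl, _, ⟨_, ⟨S, hS, rfl⟩, _, ⟨r, hr, _,
    ⟨_, rfl, _, rfl, rfl⟩, rfl⟩, rfl⟩, rfl⟩, rfl⟩, rfl⟩ := ho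
  refine ⟨S, hS, r, hr, ?_⟩
  simp only [Timed.snd_tick, add_zero, add_assoc, Finset.length_sort]

theorem sampleSize_pos (rd : ℝ → ℕ) (k : ℝ) (c : ℕ) (ub : ℝ) : 0 < sampleSize rd k c ub :=
  lt_max_of_lt_left one_pos

/-! ### The loop over the sampled candidates -/

theorem estimateLoop_nonneg (sub : VG → ℝ → Prog (ℝ × ℕ)) (ub : ℝ)
    (hsub : ∀ v b, ∀ o ∈ (sub v b).law.support, 0 ≤ o.1.1) (L : List VG) (w : ℝ) (t : ℕ)
    (hw : 0 ≤ w) : ∀ o ∈ (estimateLoop sub ub L w t).law.support, 0 ≤ o.1.1 := by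
  induction L generalizing w t with
  | nil =>
    intro o ho
    rw [estimateLoop, Prog.mem_support_pure] at ho
    rw [ho]
    exact hw
  | cons v L ih =>
    intro o ho
    simp only [estimateLoop, Prog.mem_support_bind, Prog.mem_support_lift] at ho
    obtain ⟨_, rfl, _, ⟨r, hr, s, hs, rfl⟩, rfl⟩ := ho
    exact ih _ _ (add_nonneg hw (hsub _ _ r hr)) s hs

/-- The bound that is passed to a call depends on the random outcomes of the calls before, but the
mean of a call is the same for all bounds. -/
theorem mean_estimateLoop (sub : VG → ℝ → Prog (ℝ × ℕ)) (ub : ℝ) (W : VG → ℝ≥0∞) (L : List VG)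
    (hsub : ∀ v b, ∀ o ∈ (sub v b).law.support, 0 ≤ o.1.1)
    (hmean : ∀ v ∈ L, ∀ b, ((sub v b).mean fun r => ENNReal.ofReal r.1) = W v) (w : ℝ) (t : ℕ)
    (hw : 0 ≤ w) : ((estimateLoop sub ub L w t).mean fun r => ENNReal.ofReal r.1) =
      ENNReal.ofReal w + (L.map W).sum := by
  induction L generalizing w t with
  | nil => simp [estimateLoop, Prog.mean_pure]
  | cons v L ih =>
    simp only [estimateLoop, Prog.mean_bind, Prog.mean_lift]
    rw [Prog.mean_congr (g' := fun r => (ENNReal.ofReal w + (L.map W).sum) + ENNReal.ofReal r.1),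
      Prog.mean_const_add, hmean v (by simp)]
    · simp only [List.map_cons, List.sum_cons]
      ring
    · intro o ho
      have ho' := hsub _ _ o ho
      rw [ih (fun v hv b => hmean v (by simp [hv]) b) _ _ (add_nonneg hw ho'),
        ENNReal.ofReal_add hw ho']
      ring

theorem steps_estimateLoop_le (sub : VG → ℝ → Prog (ℝ × ℕ)) (ub : ℝ) (T : VG → ℝ) (L : List VG)
    (hsub : ∀ v ∈ L, ∀ b, ∀ o ∈ (sub v b).law.support, (o.2 : ℝ) ≤ T v) (w : ℝ) (t : ℕ) :
    ∀ o ∈ (estimateLoop sub ub L w t).law.support, (o.2 : ℝ) ≤ L.length + (L.map T).sum := by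
  induction L generalizing w t with
  | nil =>
    intro o ho
    rw [estimateLoop, Prog.mem_support_pure] at ho
    simp [ho]
  | cons v L ih =>
    intro o ho
    simp only [estimateLoop, Prog.mem_support_bind, Prog.mem_support_lift] at ho
    obtain ⟨_, rfl, _, ⟨r, hr, s, hs, rfl⟩, rfl⟩ := ho
    have h1 := hsub v (by simp) _ r hr
    have h2 := ih (fun v hv => hsub v (by simp [hv])) _ _ s hs
    simp only [Timed.snd_tick, List.length_cons, List.map_cons, List.sum_cons]
    push_cast
    linarith

/-- If the bound is large enough for all calls, then every call gets a large bound. -/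
theorem estimateLoop_eq_of_le (sub : VG → ℝ → Prog (ℝ × ℕ)) (ub U : ℝ) (e : VG → ℝ)
    (tr : VG → ℕ) (L : List VG)
    (hsub : ∀ v ∈ L, ∀ b, U ≤ b → ∀ o ∈ (sub v b).law.support, o.1 = (e v, tr v)) (w : ℝ) (t : ℕ)
    (hub : L.length * U ≤ ub - (t + (L.map tr).sum : ℕ)) (hU : 0 ≤ U) :
    ∀ o ∈ (estimateLoop sub ub L w t).law.support,
      o.1 = (w + (L.map e).sum, t + (L.map tr).sum) := by
  induction L generalizing w t with
  | nil =>
    intro o ho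
    rw [estimateLoop, Prog.mem_support_pure] at ho
    simp [ho]
  | cons v L ih =>
    intro o ho
    simp only [estimateLoop, Prog.mem_support_bind, Prog.mem_support_lift] at ho
    obtain ⟨_, rfl, _, ⟨r, hr, s, hs, rfl⟩, rfl⟩ := ho
    simp only [List.length_cons, List.map_cons, List.sum_cons] at hub ⊢
    push_cast at hub
    have hr' := hsub v (by simp) _ (by
      rw [le_div_iff₀ (by positivity)]
      have : (0 : ℝ) ≤ tr v := Nat.cast_nonneg _
      have : (0 : ℝ) ≤ ((L.map tr).sum : ℕ) := Nat.cast_nonneg _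
      push_cast at *
      linarith) r hr
    rw [hr'] at hs
    have := ih (fun v hv => hsub v (by simp [hv])) _ _ (by
      push_cast
      linarith) s hs
    simp only [this, add_assoc]

end

section

set_option linter.unusedSectionVars false

variable {Vq VG Λ : Type} [Fintype Vq] [LinearOrder Vq] [Fintype VG] [LinearOrder VG]
  {q : LabeledGraph Vq Λ} {G : LabeledGraph VG Λ}

/-! ### Unbiasedness -/

theorem estimateW_nonneg (CS : CandidateSpace q G) (rd : ℝ → ℕ) (k : ℝ) (M : List (Vq × VG))
    (ub : ℝ) : ∀ o ∈ (estimateW CS rd k M ub).law.support, 0 ≤ o.1.1 := by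
  induction hn : Fintype.card Vq - M.length generalizing M ub with
  | zero =>
    intro o ho
    rw [mem_support_estimateW_of_card_le CS rd k ub M (by omega) ho]
    exact zero_le_one
  | succ n ih =>
    intro o ho
    have hlt : M.length < Fintype.card Vq := by omega
    obtain ⟨u, hu, -⟩ := exists_chooseExtendableVertex CS M hlt
    by_cases hC : (extendableCandidates CS u M).1 = []
    · rw [mem_support_estimateW_of_eq_nil CS rd k ub M hlt hu hC ho]
    · obtain ⟨S, -, r, hr, rfl⟩ := mem_support_estimateW_of_ne_nil CS rd k ub M hlt hu hC ho
      refine mul_nonneg (by positivity) (estimateLoop_nonneg _ ub ?_ _ 0 0 le_rfl r hr)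
      intro v b o ho
      exact ih ((u, v) :: M) b (by rw [List.length_cons]; omega) o ho

/-- By induction on the number of unmapped vertices: the sampled candidates are weighted by the
inverse of the probability to be sampled, and the extensions of `M` are divided up among all
candidates. -/
theorem mean_estimateW (CS : CandidateSpace q G) (rd : ℝ → ℕ) (k : ℝ) (M : List (Vq × VG))
    (hM : IsPartialEmbedding q G M) (ub : ℝ) :
    ((estimateW CS rd k M ub).mean fun r => ENNReal.ofReal r.1) = numExtensions q G M := by
  induction hn : Fintype.card Vq - M.length generalizing M ub with
  | zero =>
    rw [estimateW_of_card_le CS rd k ub M (by omega), numExtensions_of_card_le hM (by omega)]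
    simp [Prog.mean_bind, Prog.mean_lift, Prog.mean_pure]
  | succ n ih =>
    have hlt : M.length < Fintype.card Vq := by omega
    obtain ⟨u, hu, huM⟩ := exists_chooseExtendableVertex CS M hlt
    have hsum := sum_numExtensions_extendableCandidates CS huM
    by_cases hC : (extendableCandidates CS u M).1 = []
    · rw [estimateW_of_eq_nil CS rd k ub M hlt hu hC]
      rw [hC] at hsum
      simp [Prog.mean_bind, Prog.mean_lift, Prog.mean_pure, ← hsum]
    · rw [estimateW_of_ne_nil CS rd k ub M hlt hu hC]
      have hnodup := nodup_extendableCandidates CS u M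
      have hcons : ∀ v ∈ (extendableCandidates CS u M).1, IsPartialEmbedding q G ((u, v) :: M) :=
        fun v hv => hM.cons_extendableCandidates huM hv
      generalize (extendableCandidates CS u M).1 = C at *
      simp only [Prog.mean_bind, Prog.mean_lift, Prog.mean_pure]
      have hcard : C.toFinset.card = C.length := List.toFinset_card_of_nodup hnodup
      have hpos : 0 < C.length := List.length_pos_of_ne_nil hC
      rw [mean_randomSubset]
      have hs : 0 < min (sampleSize rd k C.length ub) C.toFinset.card :=
        lt_min (sampleSize_pos _ _ _ _) (hcard ▸ hpos)
      have hN : 0 < (C.toFinset.powersetCard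
          (min (sampleSize rd k C.length ub) C.toFinset.card)).card :=
        Finset.card_pos.2 (powersetCard_min_nonempty _ _)
      generalize min (sampleSize rd k C.length ub) C.toFinset.card = s at *
      have hone : ∀ S ∈ C.toFinset.powersetCard s,
          ((estimateLoop (fun v b => estimateW CS rd k ((u, v) :: M) b) ub
              (S.sort (· ≤ ·)) 0 0).mean fun r
            => ENNReal.ofReal ((C.length : ℝ) / ((S.sort (· ≤ ·)).length : ℝ) * r.1)) =
          (C.length : ℝ≥0∞) / s * ∑ v ∈ S, (numExtensions q G ((u, v) :: M) : ℝ≥0∞) := by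
        intro S hS
        rw [Finset.mem_powersetCard] at hS
        simp only [Finset.length_sort, hS.2]
        have h1 : ∀ x : ℝ, ENNReal.ofReal ((C.length : ℝ) / (s : ℝ) * x) =
            (C.length : ℝ≥0∞) / s * ENNReal.ofReal x := by
          intro x
          rw [ENNReal.ofReal_mul (by positivity), ENNReal.ofReal_div_of_pos (by positivity),
            ENNReal.ofReal_natCast, ENNReal.ofReal_natCast]
        simp only [h1]
        rw [Prog.mean_const_mul, mean_estimateLoop _ ub
          (fun v => (numExtensions q G ((u, v) :: M) : ℝ≥0∞)) _
          (fun v b => estimateW_nonneg CS rd k ((u, v) :: M) b) _ 0 0 le_rfl]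
        · rw [ENNReal.ofReal_zero, zero_add, ← List.sum_toFinset _ (Finset.sort_nodup _ _),
            Finset.sort_toFinset]
        · intro v hv b
          have hvC : v ∈ C := by simpa using hS.1 ((Finset.mem_sort _).1 hv)
          exact ih ((u, v) :: M) (hcons v hvC) b (by rw [List.length_cons]; omega)
      rw [Finset.sum_congr rfl hone, ← Finset.mul_sum, ← hsum]
      have hdc := sum_powersetCard_sum C.toFinset
        (fun v => (numExtensions q G ((u, v) :: M) : ℝ≥0∞)) hs
      rw [hcard] at hdc
      push_cast
      rw [div_eq_mul_inv, mul_comm (C.length : ℝ≥0∞), mul_assoc, hdc]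
      have hs0 : (s : ℝ≥0∞) ≠ 0 := by exact_mod_cast hs.ne'
      have hN0 : ((C.toFinset.powersetCard s).card : ℝ≥0∞) ≠ 0 := by exact_mod_cast hN.ne'
      rw [mul_assoc, ENNReal.inv_mul_cancel_left hs0 (ENNReal.natCast_ne_top s),
        ENNReal.inv_mul_cancel_left hN0 (ENNReal.natCast_ne_top _)]

theorem isUnbiasedFor_estimateW (CS : CandidateSpace q G) (rd : ℝ → ℕ) (k : ℝ)
    (M : List (Vq × VG)) (hM : IsPartialEmbedding q G M) (ub : ℝ) :
    IsUnbiasedFor (estimateW CS rd k M ub).law (numExtensions q G M) :=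
  isUnbiasedFor_of_mean (estimateW_nonneg CS rd k M ub) (mean_estimateW CS rd k M hM ub)

theorem isPartialEmbedding_nil : IsPartialEmbedding q G [] :=
  ⟨by simp, by simp, by simp, by simp⟩

theorem isUnbiasedFor_candidateGraphSampling (CS : CandidateSpace q G) (rd : ℝ → ℕ) (k ub : ℝ) :
    IsUnbiasedFor (candidateGraphSampling CS rd k ub) (numEmbeddings q G) := by
  rw [← numExtensions_nil]
  exact isUnbiasedFor_estimateW CS rd k [] isPartialEmbedding_nil ub

/-! ### Exhaustive sampling -/

/-- With sampling ratio `1` the sample is everything as soon as the bound admits it. -/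
theorem sampleSize_one_of_le {rd : ℝ → ℕ} (hrd : ∀ n : ℕ, rd n = n) {c : ℕ} (hc : 0 < c) {ub : ℝ}
    (h : (c : ℝ) ≤ ub) : sampleSize rd 1 c ub = c := by
  rw [sampleSize, div_one, min_eq_left h, hrd, min_self, max_eq_right (Nat.succ_le_of_lt hc)]

theorem exists_forall_estimateW_eq_backtracking (CS : CandidateSpace q G) {rd : ℝ → ℕ}
    (hrd : ∀ n : ℕ, rd n = n) (M : List (Vq × VG)) :
    ∃ U : ℝ, 0 ≤ U ∧ ∀ ub, U ≤ ub → ∀ o ∈ (estimateW CS rd 1 M ub).law.support,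
      o.1 = (((backtracking CS M).1 : ℝ), (backtracking CS M).2) := by
  induction hn : Fintype.card Vq - M.length generalizing M with
  | zero =>
    have hle : Fintype.card Vq ≤ M.length := by omega
    refine ⟨0, le_rfl, fun ub _ o ho => ?_⟩
    rw [mem_support_estimateW_of_card_le CS rd 1 ub M hle ho, backtracking, dif_pos hle]
    simp
  | succ n ih =>
    have hlt : M.length < Fintype.card Vq := by omega
    obtain ⟨u, hu, huM⟩ := exists_chooseExtendableVertex CS M hlt
    rw [backtracking, dif_neg (not_le.2 hlt), hu]
    simp only
    by_cases hC : (extendableCandidates CS u M).1 = []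
    · refine ⟨0, le_rfl, fun ub _ o ho => ?_⟩
      rw [mem_support_estimateW_of_eq_nil CS rd 1 ub M hlt hu hC ho, if_pos hC]
      simp
    · rw [if_neg hC]
      choose U hU0 hU using fun v => ih ((u, v) :: M) (by rw [List.length_cons]; omega)
      have hsupp := fun ub o ho => mem_support_estimateW_of_ne_nil CS rd 1 ub M hlt hu hC
        (o := o) ho
      have hnodup := nodup_extendableCandidates CS u M
      generalize (extendableCandidates CS u M).1 = C at *
      have hcard : C.toFinset.card = C.length := List.toFinset_card_of_nodup hnodup
      have hpos : 0 < C.length := List.length_pos_of_ne_nil hC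
      have hfst : (C.map fun v => backtracking CS ((u, v) :: M)).sum.1 =
          ∑ v ∈ C.toFinset, (backtracking CS ((u, v) :: M)).1 := by
        rw [List.sum_toFinset _ hnodup]
        simpa [Function.comp_def] using map_list_sum (AddMonoidHom.fst ℕ ℕ)
          (C.map fun v => backtracking CS ((u, v) :: M))
      have hsnd : (C.map fun v => backtracking CS ((u, v) :: M)).sum.2 =
          ∑ v ∈ C.toFinset, (backtracking CS ((u, v) :: M)).2 := by
        rw [List.sum_toFinset _ hnodup]
        simpa [Function.comp_def] using map_list_sum (AddMonoidHom.snd ℕ ℕ)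
          (C.map fun v => backtracking CS ((u, v) :: M))
      rw [hfst, hsnd]
      have hUs : 0 ≤ ∑ v ∈ C.toFinset, U v := Finset.sum_nonneg fun v _ => hU0 v
      -- The second term leaves `∑ v, U v` for each call even after all trials have been counted.
      refine ⟨max C.length (C.length * ∑ v ∈ C.toFinset, U v +
        (∑ v ∈ C.toFinset, (backtracking CS ((u, v) :: M)).2 : ℕ)), by positivity, ?_⟩
      intro ub hub o ho
      obtain ⟨S, hS, r, hr, rfl⟩ := hsupp ub o ho
      rw [sampleSize_one_of_le hrd hpos ((le_max_left _ _).trans hub), hcard, min_self,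
        Finset.mem_powersetCard] at hS
      obtain rfl : S = C.toFinset := Finset.eq_of_subset_of_card_le hS.1 (by omega)
      have hloop := estimateLoop_eq_of_le _ ub (∑ v ∈ C.toFinset, U v)
        (fun v => ((backtracking CS ((u, v) :: M)).1 : ℝ))
        (fun v => (backtracking CS ((u, v) :: M)).2) (C.toFinset.sort (· ≤ ·)) (by
          intro v hv b hb o ho
          exact hU v b ((Finset.single_le_sum (fun v _ => hU0 v)
            ((Finset.mem_sort _).1 hv)).trans hb) o ho) 0 0 (by
          rw [← List.sum_toFinset _ (Finset.sort_nodup _ _), Finset.sort_toFinset, zero_add,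
            Finset.length_sort, hcard]
          have := (le_max_right _ _).trans hub
          linarith) hUs r hr
      rw [hloop, ← List.sum_toFinset _ (Finset.sort_nodup _ _),
        ← List.sum_toFinset _ (Finset.sort_nodup _ _), Finset.sort_toFinset, hcard,
        div_self (by positivity), one_mul, zero_add, zero_add]
      simp

theorem exists_forall_candidateGraphSampling_eq (CS : CandidateSpace q G) {rd : ℝ → ℕ}
    (hrd : ∀ n : ℕ, rd n = n) :
    ∃ U : ℝ, ∀ ub : ℝ, U ≤ ub → ∀ o ∈ (candidateGraphSampling CS rd 1 ub).support,
      o.1.1 = (numEmbeddings q G : ℝ) ∧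
      o.1.1 = ((backtracking CS []).1 : ℝ) ∧ o.1.2 = (backtracking CS []).2 := by
  obtain ⟨U, -, hU⟩ := exists_forall_estimateW_eq_backtracking CS hrd []
  refine ⟨U, fun ub hub o ho => ?_⟩
  have h1 : ((backtracking CS []).1 : ℝ) = numEmbeddings q G :=
    eq_of_isUnbiasedFor (isUnbiasedFor_candidateGraphSampling CS rd 1 ub) fun o ho => by
      rw [hU ub hub o ho]
  rw [hU ub hub o ho]
  exact ⟨h1, rfl, rfl⟩

theorem tendsto_candidateGraphSampling (CS : CandidateSpace q G) {rd : ℝ → ℕ}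
    (hrd : ∀ n : ℕ, rd n = n) {ε : ℝ} (hε : 0 < ε) : Filter.Tendsto
      (fun ub : ℝ => (candidateGraphSampling CS rd 1 ub).toOuterMeasure
        {o | ε ≤ |o.1.1 - (numEmbeddings q G : ℝ)|}) Filter.atTop (nhds 0) := by
  obtain ⟨U, hU⟩ := exists_forall_candidateGraphSampling_eq CS hrd
  refine tendsto_const_nhds.congr' ?_
  filter_upwards [Filter.eventually_ge_atTop U] with ub hub
  symm
  rw [PMF.toOuterMeasure_apply_eq_zero_iff, Set.disjoint_left]
  intro o ho hoε
  simp only [Set.mem_ofPred_eq, (hU ub hub o ho).1, sub_self, abs_zero] at hoε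
  linarith

end

/-! ### A Hölder inequality for fractional covers -/

/-- Hölder's inequality for several functions, with exponents of total at least (rather than equal
to) `1`. -/
theorem sum_prod_rpow_le_prod_rpow {ι κ : Type} (E : Finset ι) (A : Finset κ) (x : ι → ℝ)
    (hx : ∀ e ∈ E, 0 ≤ x e) (hx1 : 1 ≤ ∑ e ∈ E, x e) (a : ι → κ → ℝ)
    (ha : ∀ e ∈ E, ∀ v ∈ A, 0 ≤ a e v) (B : ι → ℝ) (hB : ∀ e ∈ E, 0 < B e)
    (hsum : ∀ e ∈ E, ∑ v ∈ A, a e v ≤ B e) :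
    ∑ v ∈ A, ∏ e ∈ E, a e v ^ x e ≤ ∏ e ∈ E, B e ^ x e := by
  set X := ∑ e ∈ E, x e with hX
  have hX0 : 0 < X := by linarith
  have hle : ∀ e ∈ E, ∀ v ∈ A, a e v / B e ≤ 1 := fun e he v hv =>
    (div_le_one (hB e he)).2 ((Finset.single_le_sum (ha e he) hv).trans (hsum e he))
  have h0 : ∀ e ∈ E, ∀ v ∈ A, 0 ≤ a e v / B e := fun e he v hv =>
    div_nonneg (ha e he v hv) (hB e he).le
  -- After normalization the factors are at most `1`, so the exponents can be scaled down to have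
  -- total `1`, and the geometric mean is at most the arithmetic one.
  have hv : ∀ v ∈ A, ∏ e ∈ E, (a e v / B e) ^ x e ≤ ∑ e ∈ E, x e / X * (a e v / B e) := by
    intro v hv
    refine le_trans ?_ (Real.geom_mean_le_arith_mean_weighted E (fun e => x e / X)
      (fun e => a e v / B e) (fun e he => div_nonneg (hx e he) hX0.le)
      (by rw [← Finset.sum_div, ← hX, div_self hX0.ne']) fun e he => h0 e he v hv)
    refine Finset.prod_le_prod (fun e he => Real.rpow_nonneg (h0 e he v hv) _) fun e he => ?_
    rcases (h0 e he v hv).eq_or_lt with h | h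
    · rw [← h]
      rcases (hx e he).eq_or_lt with h' | h'
      · simp [← h']
      · rw [Real.zero_rpow h'.ne', Real.zero_rpow (div_pos h' hX0).ne']
    · exact Real.rpow_le_rpow_of_exponent_ge h (hle e he v hv)
        (div_le_self (hx e he) hx1)
  have hfac : ∀ v ∈ A, ∏ e ∈ E, a e v ^ x e =
      (∏ e ∈ E, B e ^ x e) * ∏ e ∈ E, (a e v / B e) ^ x e := by
    intro v hv
    rw [← Finset.prod_mul_distrib]
    refine Finset.prod_congr rfl fun e he => ?_
    rw [← Real.mul_rpow (hB e he).le (h0 e he v hv), mul_div_cancel₀ _ (hB e he).ne']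
  rw [Finset.sum_congr rfl hfac, ← Finset.mul_sum]
  refine mul_le_of_le_one_right
    (Finset.prod_nonneg fun e he => Real.rpow_nonneg (hB e he).le _) ?_
  refine (Finset.sum_le_sum hv).trans ?_
  rw [Finset.sum_comm]
  calc ∑ e ∈ E, ∑ v ∈ A, x e / X * (a e v / B e)
      ≤ ∑ e ∈ E, x e / X := by
        refine Finset.sum_le_sum fun e he => ?_
        rw [← Finset.mul_sum, ← Finset.sum_div]
        exact mul_le_of_le_one_right (div_nonneg (hx e he) hX0.le)
          ((div_le_one (hB e he)).2 (hsum e he))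
    _ = 1 := by rw [← Finset.sum_div, ← hX, div_self hX0.ne']

/-! ### The Atserias–Grohe–Marx weight of a partial mapping -/

section

set_option linter.unusedSectionVars false

variable {Vq VG Λ : Type} [Fintype Vq] [Fintype VG]
  {q : LabeledGraph Vq Λ} {G : LabeledGraph VG Λ}

open scoped Classical in
/-- The part of the relation of `(u, u')` that is consistent with the mapping `M`. -/
noncomputable def consistentRelation (q : LabeledGraph Vq Λ) (G : LabeledGraph VG Λ)
    (M : List (Vq × VG)) (u u' : Vq) : Finset (VG × VG) :=
  (edgeRelation q G u u').filter fun r =>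
    ∀ p ∈ M, (p.1 = u → r.1 = p.2) ∧ (p.1 = u' → r.2 = p.2)

theorem mem_consistentRelation (M : List (Vq × VG)) (u u' : Vq) (r : VG × VG) :
    r ∈ consistentRelation q G M u u' ↔
      (G.graph.Adj r.1 r.2 ∧ G.label r.1 = q.label u ∧ G.label r.2 = q.label u') ∧
        ∀ p ∈ M, (p.1 = u → r.1 = p.2) ∧ (p.1 = u' → r.2 = p.2) := by
  simp [consistentRelation, edgeRelation]

theorem card_consistentRelation_comm (M : List (Vq × VG)) (u u' : Vq) :
    (consistentRelation q G M u u').card = (consistentRelation q G M u' u).card := by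
  refine Finset.card_bij' (fun p _ => p.swap) (fun p _ => p.swap) ?_ ?_ (by simp) (by simp)
  all_goals
    intro r hr
    rw [mem_consistentRelation] at hr ⊢
    exact ⟨⟨hr.1.1.symm, hr.1.2.2, hr.1.2.1⟩, fun p hp => (hr.2 p hp).symm⟩

/-- The number of pairs in the relation of an edge that are consistent with `M`. -/
noncomputable def consistentSize (q : LabeledGraph Vq Λ) (G : LabeledGraph VG Λ)
    (M : List (Vq × VG)) : Sym2 Vq → ℕ :=
  Sym2.lift ⟨fun u u' => (consistentRelation q G M u u').card, card_consistentRelation_comm M⟩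

theorem consistentSize_mk (M : List (Vq × VG)) (u u' : Vq) :
    consistentSize q G M s(u, u') = (consistentRelation q G M u u').card := rfl

theorem consistentSize_nil (e : Sym2 Vq) : consistentSize q G [] e = relationSize q G e := by
  induction e with
  | _ u u' => simp [consistentSize_mk, relationSize, consistentRelation]

theorem consistentSize_cons_of_notMem (M : List (Vq × VG)) (u : Vq) (v : VG) (e : Sym2 Vq)
    (hu : u ∉ e) : consistentSize q G ((u, v) :: M) e = consistentSize q G M e := by
  induction e with
  | _ a b =>
    rw [Sym2.mem_iff, not_or] at hu
    rw [consistentSize_mk, consistentSize_mk]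
    congr 1
    ext r
    simp [mem_consistentRelation, hu.1, hu.2]

/-- Mapping `u` to different vertices selects disjoint parts of the relation of an edge at `u`. -/
theorem sum_consistentSize_cons_le (M : List (Vq × VG)) (u : Vq) (e : Sym2 Vq) (hu : u ∈ e)
    (A : Finset VG) :
    ∑ v ∈ A, consistentSize q G ((u, v) :: M) e ≤ consistentSize q G M e := by
  classical
  obtain ⟨u', rfl⟩ := Sym2.mem_iff_exists.1 hu
  simp only [consistentSize_mk]
  rw [← Finset.card_biUnion]
  · refine Finset.card_le_card (Finset.biUnion_subset.2 fun v _ r hr => ?_)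
    rw [mem_consistentRelation, List.forall_mem_cons] at hr
    exact (mem_consistentRelation M u u' r).2 ⟨hr.1, hr.2.2⟩
  · intro v _ w _ hvw
    rw [Function.onFun, Finset.disjoint_left]
    intro r hr hr'
    rw [mem_consistentRelation, List.forall_mem_cons] at hr hr'
    exact hvw ((hr.2.1.1 rfl).symm.trans (hr'.2.1.1 rfl))

open scoped Classical in
/-- The Atserias–Grohe–Marx product of the relations restricted to what is consistent with `M`. -/
noncomputable def agmWeight (q : LabeledGraph Vq Λ) (G : LabeledGraph VG Λ) (x : Sym2 Vq → ℝ)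
    (M : List (Vq × VG)) : ℝ :=
  ∏ e ∈ q.graph.edgeFinset, (consistentSize q G M e : ℝ) ^ x e

/-- The weights of the extensions of `M` by one more vertex add up to at most the weight of `M`. -/
theorem sum_agmWeight_cons_le {x : Sym2 Vq → ℝ} (hx : IsFractionalEdgeCover q.graph x)
    (M : List (Vq × VG)) (hM : ∀ e ∈ q.graph.edgeSet, 0 < consistentSize q G M e) (u : Vq)
    (A : Finset VG) : ∑ v ∈ A, agmWeight q G x ((u, v) :: M) ≤ agmWeight q G x M := by
  classical
  have hsplit : ∀ M', agmWeight q G x M' =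
      (∏ e ∈ q.graph.edgeFinset with u ∈ e, (consistentSize q G M' e : ℝ) ^ x e) *
        ∏ e ∈ q.graph.edgeFinset with u ∉ e, (consistentSize q G M' e : ℝ) ^ x e := by
    intro M'
    rw [agmWeight]
    convert (Finset.prod_filter_mul_prod_filter_not q.graph.edgeFinset (fun e => u ∈ e) _).symm
  have hconst : ∀ v, ∏ e ∈ q.graph.edgeFinset with u ∉ e,
      (consistentSize q G ((u, v) :: M) e : ℝ) ^ x e =
      ∏ e ∈ q.graph.edgeFinset with u ∉ e, (consistentSize q G M e : ℝ) ^ x e := by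
    intro v
    refine Finset.prod_congr rfl fun e he => ?_
    rw [consistentSize_cons_of_notMem M u v e (Finset.mem_filter.1 he).2]
  simp only [hsplit, hconst]
  rw [← Finset.sum_mul]
  refine mul_le_mul_of_nonneg_right ?_ (Finset.prod_nonneg fun e _ => by positivity)
  refine sum_prod_rpow_le_prod_rpow _ A x ?_ ?_
    (fun e v => (consistentSize q G ((u, v) :: M) e : ℝ)) (fun _ _ _ _ => Nat.cast_nonneg _) _ ?_ ?_
  · intro e he
    refine hx.1 e ?_
    have := (Finset.mem_filter.1 he).1
    rw [SimpleGraph.mem_edgeFinset] at this ⊢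
    exact this
  · convert hx.2 u
  · intro e he
    have := hM e (SimpleGraph.mem_edgeFinset.1 (Finset.mem_filter.1 he).1)
    exact_mod_cast this
  · intro e he
    exact_mod_cast sum_consistentSize_cons_le M u e (Finset.mem_filter.1 he).2 A

theorem isFractionalEdgeCover_one [Nontrivial Vq] (hq : q.graph.Connected) :
    IsFractionalEdgeCover q.graph fun _ => 1 := by
  classical
  refine ⟨fun _ _ => zero_le_one, fun u => ?_⟩
  obtain ⟨u', hu'⟩ := hq.preconnected.exists_adj_of_nontrivial u
  rw [Finset.sum_const, nsmul_eq_mul, mul_one, Nat.one_le_cast, Nat.one_le_iff_ne_zero,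
    ← Nat.pos_iff_ne_zero, Finset.card_pos]
  refine ⟨s(u, u'), ?_⟩
  rw [Finset.mem_filter]
  exact ⟨SimpleGraph.mem_edgeFinset.2 hu', Sym2.mem_mk_left u u'⟩

theorem exists_adj_of_mem_initialCand {u u' : Vq} {v : VG} (hv : v ∈ initialCand q G u)
    (hadj : q.graph.Adj u u') : ∃ v', G.graph.Adj v v' ∧ G.label v' = q.label u' := by
  have h1 : 0 < labelDegree q u (q.label u') :=
    have : Nonempty {y : Vq // q.graph.Adj u y ∧ q.label y = q.label u'} := ⟨⟨u', hadj, rfl⟩⟩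
    Nat.card_pos
  have h2 := h1.trans_le (hv.2 (q.label u'))
  obtain ⟨⟨v', h⟩⟩ := (Nat.card_pos_iff.1 h2).1
  exact ⟨v', h⟩

/-- A partial embedding all of whose images are initial candidates. -/
structure IsCandidateEmbedding (q : LabeledGraph Vq Λ) (G : LabeledGraph VG Λ)
    (M : List (Vq × VG)) : Prop extends IsPartialEmbedding q G M where
  mem_initialCand : ∀ p ∈ M, p.2 ∈ initialCand q G p.1

theorem IsPartialEmbedding.eq_of_mem {M : List (Vq × VG)} (hM : IsPartialEmbedding q G M)
    {p p' : Vq × VG} (hp : p ∈ M) (hp' : p' ∈ M) (h : p.1 = p'.1) : p = p' :=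
  List.inj_on_of_nodup_map hM.functional hp hp' h

theorem consistentSize_pos {M : List (Vq × VG)} (hM : IsCandidateEmbedding q G M)
    (hR : ∀ e ∈ q.graph.edgeSet, 0 < relationSize q G e) :
    ∀ e ∈ q.graph.edgeSet, 0 < consistentSize q G M e := by
  -- If only one end of the edge is mapped, the neighbour demanded by `initialCand` extends it.
  have key : ∀ a b, q.graph.Adj a b → (∃ p ∈ M, p.1 = a) →
      0 < (consistentRelation q G M a b).card := by
    rintro a b hab ⟨p, hp, rfl⟩
    rw [Finset.card_pos]
    by_cases hb : ∃ p' ∈ M, p'.1 = b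
    · obtain ⟨p', hp', rfl⟩ := hb
      refine ⟨(p.2, p'.2), (mem_consistentRelation _ _ _ _).2
        ⟨⟨hM.adj p hp p' hp' hab, hM.label p hp, hM.label p' hp'⟩, fun r hr => ⟨?_, ?_⟩⟩⟩
      · exact fun h => by rw [hM.eq_of_mem hr hp h]
      · exact fun h => by rw [hM.eq_of_mem hr hp' h]
    · obtain ⟨v', h1, h2⟩ := exists_adj_of_mem_initialCand (hM.mem_initialCand p hp) hab
      refine ⟨(p.2, v'), (mem_consistentRelation _ _ _ _).2
        ⟨⟨h1, hM.label p hp, h2⟩, fun r hr => ⟨?_, ?_⟩⟩⟩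
      · exact fun h => by rw [hM.eq_of_mem hr hp h]
      · exact fun h => absurd ⟨r, hr, h⟩ hb
  intro e he
  have hRe := hR e he
  induction e with
  | _ a b =>
    rw [SimpleGraph.mem_edgeSet] at he
    by_cases ha : ∃ p ∈ M, p.1 = a
    · exact key a b he ha
    · by_cases hb : ∃ p ∈ M, p.1 = b
      · rw [Sym2.eq_swap]
        exact key b a he.symm hb
      · rw [← consistentSize_nil, consistentSize_mk, Finset.card_pos] at hRe
        obtain ⟨r, hr⟩ := hRe
        rw [consistentSize_mk, Finset.card_pos]
        refine ⟨r, (mem_consistentRelation _ _ _ _).2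
          ⟨((mem_consistentRelation _ _ _ _).1 hr).1, fun p hp => ⟨?_, ?_⟩⟩⟩
        · exact fun h => absurd ⟨p, hp, h⟩ ha
        · exact fun h => absurd ⟨p, hp, h⟩ hb

end

section

set_option linter.unusedSectionVars false

variable {Vq VG Λ : Type} [Fintype Vq] [LinearOrder Vq] [Fintype VG] [LinearOrder VG]
  {q : LabeledGraph Vq Λ} {G : LabeledGraph VG Λ}

theorem IsCandidateEmbedding.cons_extendableCandidates {CS : CandidateSpace q G} {u : Vq}
    {M : List (Vq × VG)} (hM : IsCandidateEmbedding q G M) (hu : u ∉ M.map Prod.fst) {v : VG}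
    (hv : v ∈ (extendableCandidates CS u M).1) : IsCandidateEmbedding q G ((u, v) :: M) := by
  refine ⟨hM.toIsPartialEmbedding.cons_extendableCandidates hu hv, ?_⟩
  rw [List.forall_mem_cons]
  exact ⟨scannedSet_subset_initialCand CS u M ((mem_extendableCandidates CS u M v).1 hv).1,
    hM.mem_initialCand⟩

/-- Every scanned vertex takes part in a consistent pair of every edge at `u`: the other end of the
pair is the image of the other end of the edge if that is mapped, and is provided by `initialCand`
otherwise. -/
theorem card_scannedSet_le_consistentSize (CS : CandidateSpace q G) {u : Vq}
    {M : List (Vq × VG)} (hM : IsCandidateEmbedding q G M) (hu : u ∉ M.map Prod.fst)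
    (e : Sym2 Vq) (he : e ∈ q.graph.edgeSet) (hue : u ∈ e) :
    (scannedSet CS u M).card ≤ consistentSize q G M e := by
  classical
  obtain ⟨u', rfl⟩ := Sym2.mem_iff_exists.1 hue
  rw [SimpleGraph.mem_edgeSet] at he
  have huM : ∀ p ∈ M, p.1 ≠ u := fun p hp h => hu (List.mem_map.2 ⟨p, hp, h⟩)
  rw [consistentSize_mk]
  by_cases hu' : ∃ p ∈ M, p.1 = u'
  · obtain ⟨p, hp, rfl⟩ := hu'
    refine (card_scannedSet_le CS u M hp he).trans ?_
    refine Finset.card_le_card_of_injOn (fun w => (w, p.2)) ?_ ?_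
    · intro w hw
      obtain ⟨h1, -, h2⟩ := CS.edges_initial p.1 u he.symm _
        ((mem_nbrs CS u p.1 p.2 w).1 hw)
      refine (mem_consistentRelation _ _ _ _).2
        ⟨⟨h1.symm, h2.1, hM.label p hp⟩, fun r hr => ⟨fun h => absurd h (huM r hr), ?_⟩⟩
      exact fun h => by rw [hM.eq_of_mem hr hp h]
    · intro w _ w' _ h
      exact congrArg Prod.fst h
  · have hex : ∀ w ∈ scannedSet CS u M, ∃ v', G.graph.Adj w v' ∧ G.label v' = q.label u' :=
      fun w hw => exists_adj_of_mem_initialCand (scannedSet_subset_initialCand CS u M hw) he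
    choose! f hf using hex
    refine Finset.card_le_card_of_injOn (fun w => (w, f w)) ?_ ?_
    · intro w hw
      refine (mem_consistentRelation _ _ _ _).2
        ⟨⟨(hf w hw).1, (scannedSet_subset_initialCand CS u M hw).1, (hf w hw).2⟩,
          fun r hr => ⟨fun h => absurd h (huM r hr), fun h => absurd ⟨r, hr, h⟩ hu'⟩⟩
    · intro w _ w' _ h
      exact congrArg Prod.fst h

theorem one_le_agmWeight {x : Sym2 Vq → ℝ} (hx : IsFractionalEdgeCover q.graph x)
    {M : List (Vq × VG)} (hM : ∀ e ∈ q.graph.edgeSet, 0 < consistentSize q G M e) :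
    1 ≤ agmWeight q G x M := by
  classical
  rw [agmWeight, ← Finset.prod_const_one (s := q.graph.edgeFinset)]
  refine Finset.prod_le_prod (fun _ _ => zero_le_one) fun e he => ?_
  refine Real.one_le_rpow ?_ (hx.1 e he)
  exact_mod_cast hM e (SimpleGraph.mem_edgeFinset.1 he)

theorem card_scannedSet_le_agmWeight (CS : CandidateSpace q G) {x : Sym2 Vq → ℝ}
    (hx : IsFractionalEdgeCover q.graph x) {u : Vq} {M : List (Vq × VG)}
    (hM : IsCandidateEmbedding q G M) (hu : u ∉ M.map Prod.fst)
    (hR : ∀ e ∈ q.graph.edgeSet, 0 < relationSize q G e) :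
    ((scannedSet CS u M).card : ℝ) ≤ agmWeight q G x M := by
  classical
  have hpos := consistentSize_pos hM hR
  rcases Nat.eq_zero_or_pos (scannedSet CS u M).card with h0 | h0
  · rw [h0, Nat.cast_zero]
    exact zero_le_one.trans (one_le_agmWeight hx hpos)
  have h1 : (1 : ℝ) ≤ (scannedSet CS u M).card := by exact_mod_cast h0
  calc ((scannedSet CS u M).card : ℝ)
      ≤ ((scannedSet CS u M).card : ℝ) ^ ∑ e ∈ q.graph.edgeFinset with u ∈ e, x e := by
        refine Real.self_le_rpow_of_one_le h1 ?_
        convert hx.2 u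
    _ = ∏ e ∈ q.graph.edgeFinset with u ∈ e, ((scannedSet CS u M).card : ℝ) ^ x e :=
        Real.rpow_sum_of_pos (zero_lt_one.trans_le h1) _ _
    _ ≤ ∏ e ∈ q.graph.edgeFinset, (consistentSize q G M e : ℝ) ^ x e := by
        rw [Finset.prod_filter]
        refine Finset.prod_le_prod (fun e _ => ?_) fun e he => ?_
        · split_ifs <;> positivity
        · have hxe := hx.1 e (by convert he)
          have he' := SimpleGraph.mem_edgeFinset.1 he
          split_ifs with hue
          · refine Real.rpow_le_rpow (by positivity) ?_ hxe
            exact_mod_cast card_scannedSet_le_consistentSize CS hM hu e he' hue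
          · refine Real.one_le_rpow ?_ hxe
            exact_mod_cast hpos e he'
    _ = agmWeight q G x M := by rw [agmWeight]

/-! ### The running time -/

/-- The work of one call without the recursive ones.  The number of candidates occurs twice: in the
drawing of the sample, and as a bound for the number of rounds of the loop. -/
theorem chooseExtendableVertex_add_extendableCandidates_le (CS : CandidateSpace q G) (u : Vq)
    (M : List (Vq × VG)) (h : M.length < Fintype.card Vq) :
    1 + (chooseExtendableVertex CS M).2 + (extendableCandidates CS u M).2 +
      (extendableCandidates CS u M).1.length + (extendableCandidates CS u M).1.length + 1 ≤
      10 * Fintype.card Vq ^ 2 * (1 + (scannedSet CS u M).card) := by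
  have h1 := chooseExtendableVertex_snd_le CS M
  have h2 := extendableCandidates_snd_le CS u M
  have h3 := length_extendableCandidates_le CS u M
  generalize (chooseExtendableVertex CS M).2 = c at *
  generalize (extendableCandidates CS u M).2 = d at *
  generalize (extendableCandidates CS u M).1.length = l at *
  generalize (scannedSet CS u M).card = m at *
  generalize Fintype.card Vq = n at *
  generalize M.length = i at *
  obtain ⟨j, rfl⟩ := Nat.exists_eq_add_of_lt h
  nlinarith [Nat.zero_le (m * i), Nat.zero_le (m * j), Nat.zero_le (m * i * j), Nat.zero_le (i * j),
    Nat.zero_le (m * i ^ 2), Nat.zero_le (m * j ^ 2)]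

/-- The work of one call is at most a multiple of the weight of `M`, and the weights of the mappings
in the recursive calls add up to at most the weight of `M`.  So each of the remaining levels of the
recursion contributes at most the same multiple of the weight of `M`, whatever was sampled. -/
theorem steps_estimateW_le (CS : CandidateSpace q G) (rd : ℝ → ℕ) (k : ℝ) {x : Sym2 Vq → ℝ}
    (hx : IsFractionalEdgeCover q.graph x) (hR : ∀ e ∈ q.graph.edgeSet, 0 < relationSize q G e)
    (n : ℕ) (M : List (Vq × VG)) (hn : Fintype.card Vq - M.length = n)
    (hM : IsCandidateEmbedding q G M) (ub : ℝ) :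
    ∀ o ∈ (estimateW CS rd k M ub).law.support,
      (o.2 : ℝ) ≤ (1 + n * (20 * (Fintype.card Vq : ℝ) ^ 2)) * agmWeight q G x M := by
  induction n generalizing M ub with
  | zero =>
    intro o ho
    rw [mem_support_estimateW_of_card_le CS rd k ub M (by omega) ho]
    simpa using one_le_agmWeight hx (consistentSize_pos hM hR)
  | succ n ih =>
    intro o ho
    have hlt : M.length < Fintype.card Vq := by omega
    obtain ⟨u, hu, huM⟩ := exists_chooseExtendableVertex CS M hlt
    have hpos := consistentSize_pos hM hR
    have hlocal : ((1 + (chooseExtendableVertex CS M).2 + (extendableCandidates CS u M).2 +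
        (extendableCandidates CS u M).1.length + (extendableCandidates CS u M).1.length + 1 : ℕ) :
          ℝ) ≤ 20 * (Fintype.card Vq : ℝ) ^ 2 * agmWeight q G x M := by
      refine (Nat.cast_le.2
        (chooseExtendableVertex_add_extendableCandidates_le CS u M hlt)).trans ?_
      have h1 := one_le_agmWeight hx hpos
      have h2 := card_scannedSet_le_agmWeight CS hx hM huM hR
      push_cast
      rw [show (20 : ℝ) * (Fintype.card Vq : ℝ) ^ 2 * agmWeight q G x M =
        10 * (Fintype.card Vq : ℝ) ^ 2 * (agmWeight q G x M + agmWeight q G x M) by ring]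
      gcongr
    have hW : 0 ≤ agmWeight q G x M := zero_le_one.trans (one_le_agmWeight hx hpos)
    by_cases hC : (extendableCandidates CS u M).1 = []
    · rw [mem_support_estimateW_of_eq_nil CS rd k ub M hlt hu hC ho]
      rw [hC] at hlocal
      push_cast at hlocal ⊢
      simp only [List.length_nil, Nat.cast_zero, add_zero] at hlocal
      have : 0 ≤ (n : ℝ) * (20 * (Fintype.card Vq : ℝ) ^ 2) * agmWeight q G x M := by positivity
      linarith
    · obtain ⟨S, hS, r, hr, rfl⟩ := mem_support_estimateW_of_ne_nil CS rd k ub M hlt hu hC ho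
      rw [Finset.mem_powersetCard] at hS
      have hloop := steps_estimateLoop_le _ ub
        (fun v => (1 + n * (20 * (Fintype.card Vq : ℝ) ^ 2)) * agmWeight q G x ((u, v) :: M))
        (S.sort (· ≤ ·)) (fun v hv b o ho => ih ((u, v) :: M) (by rw [List.length_cons]; omega)
          (hM.cons_extendableCandidates huM
            (List.mem_toFinset.1 (hS.1 ((Finset.mem_sort _).1 hv)))) b o ho) 0 0 r hr
      rw [← List.sum_toFinset _ (Finset.sort_nodup _ _), Finset.sort_toFinset, ← Finset.mul_sum,
        Finset.length_sort] at hloop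
      have h3 : (1 + n * (20 * (Fintype.card Vq : ℝ) ^ 2)) *
          ∑ v ∈ S, agmWeight q G x ((u, v) :: M) ≤
          (1 + n * (20 * (Fintype.card Vq : ℝ) ^ 2)) * agmWeight q G x M :=
        mul_le_mul_of_nonneg_left (sum_agmWeight_cons_le hx M hpos u S) (by positivity)
      have h4 : (S.card : ℝ) ≤ (extendableCandidates CS u M).1.length := by
        exact_mod_cast (Finset.card_le_card hS.1).trans (List.toFinset_card_le _)
      push_cast at hlocal ⊢
      linarith

/-- If the relation of some edge is empty then the ends of that edge have no candidates, so the
search stops at the first vertex: it is one with the smallest candidate set. -/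
theorem steps_estimateW_nil_le_of_relationSize_eq_zero [Nonempty Vq] (CS : CandidateSpace q G)
    (rd : ℝ → ℕ) (k : ℝ) {e : Sym2 Vq} (he : e ∈ q.graph.edgeSet) (hRe : relationSize q G e = 0)
    (ub : ℝ) : ∀ o ∈ (estimateW CS rd k [] ub).law.support, o.2 ≤ 10 * Fintype.card Vq ^ 2 := by
  intro o ho
  have hlt : ([] : List (Vq × VG)).length < Fintype.card Vq := Fintype.card_pos
  obtain ⟨u, hu, hmin⟩ := smallestVertex_fst CS ((Finset.univ : Finset Vq).sort (· ≤ ·))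
    (List.ne_nil_of_length_pos (by simpa using Fintype.card_pos))
  have hu' : (chooseExtendableVertex CS []).1 = some u := by
    rw [chooseExtendableVertex, if_pos rfl, hu]
  have hempty : ∃ w, CS.cand w = ∅ := by
    induction e with
    | _ a b =>
      rw [SimpleGraph.mem_edgeSet] at he
      refine ⟨a, Finset.eq_empty_of_forall_notMem fun v hv => ?_⟩
      have hv' := CS.cand_initial a v hv
      obtain ⟨v', h1, h2⟩ := exists_adj_of_mem_initialCand hv' he
      rw [← consistentSize_nil, consistentSize_mk, Finset.card_eq_zero] at hRe
      refine Finset.notMem_empty (v, v') (hRe ▸ ?_)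
      exact (mem_consistentRelation _ _ _ _).2 ⟨⟨h1, hv'.1, h2⟩, by simp⟩
  obtain ⟨w, hw⟩ := hempty
  have hscan : (scannedSet CS u []).card = 0 := by
    have := hmin w (by simp)
    rw [hw, Finset.card_empty] at this
    exact Nat.le_zero.1 this
  have hC : (extendableCandidates CS u []).1 = [] :=
    List.eq_nil_of_length_eq_zero
      (Nat.le_zero.1 (hscan ▸ length_extendableCandidates_le CS u []))
  have h := chooseExtendableVertex_add_extendableCandidates_le CS u [] hlt
  rw [mem_support_estimateW_of_eq_nil CS rd k ub [] hlt hu' hC ho]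
  rw [hscan] at h
  simp only
  omega

open scoped Classical in
theorem steps_candidateGraphSampling_le (CS : CandidateSpace q G) (rd : ℝ → ℕ)
    (hq : q.graph.Connected) (hcard : 2 ≤ Fintype.card Vq) (k ub : ℝ) :
    ∀ o ∈ (candidateGraphSampling CS rd k ub).support,
      (o.2 : ℝ) ≤ 21 * (Fintype.card Vq : ℝ) ^ 3 * max 1 (agmBound q G) := by
  intro o ho
  have : Nontrivial Vq := Fintype.one_lt_card_iff_nontrivial.1 hcard
  have hN : (1 : ℝ) ≤ Fintype.card Vq := by exact_mod_cast (by omega : 1 ≤ Fintype.card Vq)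
  by_cases hR : ∀ e ∈ q.graph.edgeSet, 0 < relationSize q G e
  · have hpos : (0 : ℝ) < 21 * (Fintype.card Vq : ℝ) ^ 3 := by positivity
    have hle : (o.2 : ℝ) / (21 * (Fintype.card Vq : ℝ) ^ 3) ≤ agmBound q G := by
      have : Nonempty {x : Sym2 Vq → ℝ // IsFractionalEdgeCover q.graph x} :=
        ⟨⟨_, isFractionalEdgeCover_one hq⟩⟩
      refine le_ciInf fun x => ?_
      have hM : IsCandidateEmbedding q G [] := ⟨isPartialEmbedding_nil, by simp⟩
      have h1 := steps_estimateW_le CS rd k x.2 hR _ [] rfl hM ub o ho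
      have h2 : agmWeight q G x.1 [] =
          ∏ e ∈ q.graph.edgeFinset, (relationSize q G e : ℝ) ^ (x.1 e) := by
        simp only [agmWeight, consistentSize_nil]
      have h3 := one_le_agmWeight x.2 (consistentSize_pos hM hR)
      rw [← h2, div_le_iff₀ hpos, mul_comm]
      refine h1.trans (mul_le_mul_of_nonneg_right ?_ (zero_le_one.trans h3))
      have h4 : (1 : ℝ) ≤ (Fintype.card Vq : ℝ) ^ 3 := one_le_pow₀ hN
      simp only [List.length_nil, Nat.sub_zero]
      linarith
    rw [div_le_iff₀ hpos, mul_comm] at hle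
    exact hle.trans (mul_le_mul_of_nonneg_left (le_max_right _ _) hpos.le)
  · push Not at hR
    obtain ⟨e, he, hRe⟩ := hR
    have h1 : (o.2 : ℝ) ≤ 10 * (Fintype.card Vq : ℝ) ^ 2 := by
      exact_mod_cast steps_estimateW_nil_le_of_relationSize_eq_zero CS rd k he
        (Nat.le_zero.1 hRe) ub o ho
    have h2 : (Fintype.card Vq : ℝ) ^ 2 ≤ (Fintype.card Vq : ℝ) ^ 3 :=
      pow_le_pow_right₀ hN (by norm_num)
    calc (o.2 : ℝ) ≤ 21 * (Fintype.card Vq : ℝ) ^ 3 * 1 := by nlinarith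
      _ ≤ 21 * (Fintype.card Vq : ℝ) ^ 3 * max 1 (agmBound q G) := by
        gcongr
        exact le_max_left _ _

end

theorem mainTheorem1 :
    ∃ c d : ℕ, ∀ (Vq VG Λ : Type) [Fintype Vq] [LinearOrder Vq] [Fintype VG] [LinearOrder VG]
      (q : LabeledGraph Vq Λ) (G : LabeledGraph VG Λ) (CS : CandidateSpace q G) (rd : ℝ → ℕ),
      q.graph.Connected → Monotone rd → (∀ n : ℕ, rd n = n) →
      -- unbiasedness
      (∀ k : ℝ, 1 ≤ k → ∀ ub : ℝ,
        IsUnbiasedFor (candidateGraphSampling CS rd k ub) (numEmbeddings q G) ∧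
        ∀ M : List (Vq × VG), IsPartialEmbedding q G M →
          IsUnbiasedFor (estimateW CS rd k M ub).law (numExtensions q G M)) ∧
      -- consistency
      (∀ ε : ℝ, 0 < ε → Filter.Tendsto
        (fun ub : ℝ => (candidateGraphSampling CS rd 1 ub).toOuterMeasure
          {o | ε ≤ |o.1.1 - (numEmbeddings q G : ℝ)|}) Filter.atTop (nhds 0)) ∧
      (∃ U : ℝ, ∀ ub : ℝ, U ≤ ub → ∀ o ∈ (candidateGraphSampling CS rd 1 ub).support,
        o.1.1 = (numEmbeddings q G : ℝ) ∧
        o.1.1 = ((backtracking CS []).1 : ℝ) ∧ o.1.2 = (backtracking CS []).2) ∧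
      -- running time
      (2 ≤ Fintype.card Vq → ∀ k : ℝ, 1 ≤ k → ∀ ub : ℝ,
        ∀ o ∈ (candidateGraphSampling CS rd k ub).support,
          (o.2 : ℝ) ≤ c * (Fintype.card Vq : ℝ) ^ d * max 1 (agmBound q G)) := by
  refine ⟨21, 3, fun Vq VG Λ _ _ _ _ q G CS rd hq _ hrd => ⟨fun k _ ub => ⟨?_, ?_⟩, ?_, ?_, ?_⟩⟩
  · exact isUnbiasedFor_candidateGraphSampling CS rd k ub
  · exact fun M hM => isUnbiasedFor_estimateW CS rd k M hM ub
  · exact fun ε hε => tendsto_candidateGraphSampling CS hrd hε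
  · exact exists_forall_candidateGraphSampling_eq CS hrd
  · intro hcard k _ ub o ho
    exact_mod_cast steps_candidateGraphSampling_le CS rd hq hcard k ub o ho
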